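/- Let $n\in\{5,7\}$, let $F=\mathbb{Q}(\zeta)$ with $\zeta=\zeta_n$ a primitive $n$-th root of unity, $\mathcal{O}_F=\mathbb{Z}[\zeta]$, let $K$ be the maximal real subfield of $F$, and let $\sigma_1,\dots,\sigma_k$ be the embeddings $K\to\mathbb{R}$. For $\alpha\in F$ put $\Sigma(\alpha)=(\sigma_1(\alpha\bar\alpha),\dots,\sigma_k(\alpha\bar\alpha))$ and $N(\alpha)=\prod_j\sigma_j(\alpha\bar\alpha)$; for weights $x\in\mathbb{R}_{>0}^k$ put $\langle\alpha,\alpha\rangle_x=\sum_j x_j\sigma_j(\alpha\bar\alpha)$. For $r\ge 0$ let $\mathcal{P}^r=((1-\zeta)^r)\subseteq\mathcal{O}_F$. A minimal vector of $\mathcal{P}^r$ for $x$ is a nonzero $\alpha\in\mathcal{P}^r$ that minimizes $\langle\alpha,\alpha\rangle_x$ among the nonzero elements of $\mathcal{P}^r$. For units $g_1,\dots,g_{k-1}$ freely generating $\mathcal{O}_F^\times$ modulo torsion and a permutation $s$ of $\{1,\dots,k-1\}$, let $A$ be the $k\times k$ matrix with rows $\Sigma(1),\Sigma(g_{s(1)}),\Sigma(g_{s(1)}g_{s(2)}),\dots,\Sigma(g_{s(1)}\cdots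 g_{s(k-1)})$, let $B$ be the $(k-1)\times k$ matrix of differences of consecutive rows of $A$, let $B_l$ be $B$ without its $l$-th column, and put $\beta_s=\left|\left(\frac{\det A}{k}\right)^k\prod_{l=1}^k\frac1{\det B_l}\right|$. Then the following hold. 1. If $n=5$, then $k=2$, free generators $g_1$ exist, and for every such $g_1$ the only value $\beta_s$ is $5/4<5$. If $n=7$, then $k=3$, and there are free generators $g_1,g_2$ for which the set of the two values $\beta_s$ is $\{49/27,56/27\}$, with maximum $56/27<7$. Every minimal vector $\alpha$ of $\mathcal{P}^r$, for any $r\ge 0$ and any positive weights, satisfies $N(\alpha)\le c\,N((1-\zeta)^r)$, where $c=5/4$ if $n=5$ and $c=56/27$ if $n=7$. 2. Every nonzero non-unit $\beta\in\mathcal{O}_F$ satisfies $N(\beta)\ge n$. 3. For all $r\ge 0$ and all positive weights $x$, the minimal vectors of $\mathcal{P}^r$ for $x$ are exactly the elements $(1-\zeta)^ru$ with $u\in\mathcal{O}_F^\times$ such that $\langle(1-\zeta)^ru,(1-\zeta)^ru\rangle_x\le\langle(1-\zeta)^ru',(1-\zeta)^ru'\rangle_x$ for all $u'\in\mathcal{O}_F^\times$.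 In particular every minimal vector is a unit times $(1-\zeta)^r$. 4. For all $r\ge 0$, an element of $\mathcal{O}_F$ is a minimal vector of $\mathcal{P}^r$ for some choice of positive weights if and only if it is of the form $(1-\zeta)^ru$ with $u\in\mathcal{O}_F^\times$. 5. For $r\ge 0$ let $\mathbb{A}_{n-1}^{(r)}=(1-T)^r\mathbb{Z}^n\subseteq\mathbb{R}^n$ be the Craig lattice, where $T$ is the cyclic shift $e_j\mapsto e_{j+1}$ (indices $0,\dots,n-1$ modulo $n$). The map $v\mapsto\sum_{i=0}^{n-1}v_i\zeta^i$ restricts to a bijection from the set of shortest nonzero vectors of $\mathbb{A}_{n-1}^{(r)}$ (Euclidean length) onto the set of elements $(1-\zeta)^ru$, $u\in\mathcal{O}_F^\times$, whose weighted norm with all weights equal to $1$ is least among all elements $(1-\zeta)^ru'$, $u'\in\mathcal{O}_F^\times$. -/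

import Mathlib

open NumberField

namespace CraigLattice

section CMField

variable (F : Type*) [Field F] [NumberField F]

/-- The real embeddings `σ_1, …, σ_k` of the maximal real subfield `K = F⁺` of `F`. -/
abbrev RealEmb : Type _ := maximalRealSubfield F →+* ℝ

variable {F}

/-- The coordinate `σ (α ᾱ)` of `Σ(α)`. For a CM field `F` the relative norm from `F` to its
maximal real subfield `K` is `α ↦ α ᾱ`. -/
noncomputable def sigmaMap (α : F) (σ : RealEmb F) : ℝ :=
  σ (Algebra.norm (maximalRealSubfield F) α)

theorem norm_eq_mul_complexConj [IsCMField F] (α : F) :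
    (Algebra.norm (maximalRealSubfield F) α : F) = α * IsCMField.complexConj F α := by
  classical
  have h : Nat.card (F ≃ₐ[maximalRealSubfield F] F) = 2 :=
    (IsCMField.isQuadraticExtension F).finrank_eq_two ▸ IsGalois.card_aut_eq_finrank _ F
  have hu : (Finset.univ : Finset (F ≃ₐ[maximalRealSubfield F] F)) =
      {1, IsCMField.complexConj F} := by
    symm
    apply Finset.eq_univ_of_card
    rw [Finset.card_pair (IsCMField.complexConj_ne_one F).symm, Fintype.card_eq_nat_card, h]
  have hn := Algebra.norm_eq_prod_automorphisms (maximalRealSubfield F) α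
  rw [hu, Finset.prod_pair (IsCMField.complexConj_ne_one F).symm] at hn
  exact hn

/-- The weighted norm `⟨α, α⟩_x = ∑_j x_j σ_j(α ᾱ)`. -/
noncomputable def weightedNorm (x : RealEmb F → ℝ) (α : F) : ℝ :=
  ∑ σ : RealEmb F, x σ * sigmaMap α σ

/-- The field norm `N_ℚ(α) = ∏_j σ_j(α ᾱ)`. -/
noncomputable def fieldNorm (α : F) : ℝ :=
  ∏ σ : RealEmb F, sigmaMap α σ

/-- `α` is a minimal vector of the lattice given by the ideal `I` with the weights `x`: a nonzero
element of `I` whose weighted norm is least among the nonzero elements of `I`. -/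
def IsMinimalVector (I : Ideal (𝓞 F)) (x : RealEmb F → ℝ) (α : 𝓞 F) : Prop :=
  α ∈ I ∧ α ≠ 0 ∧
    ∀ β ∈ I, β ≠ 0 → weightedNorm x (α : F) ≤ weightedNorm x (β : F)

/-- `g_1, …, g_m` are free generators of the unit group of `𝓞 F` modulo torsion: every unit is
`t ∏ g_i^{a_i}` for exactly one torsion unit `t` and exactly one integer vector `a`. -/
def IsFundamentalSystem {m : ℕ} (g : Fin m → (𝓞 F)ˣ) : Prop :=
  ∀ y : (𝓞 F)ˣ, ∃! ta : Units.torsion F × (Fin m → ℤ), y = ta.1 * ∏ i, g i ^ ta.2 i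

/-- The points `1, g_{s(1)}, g_{s(1)} g_{s(2)}, …, ∏ g_{s(l)}` of `Δ_s`. -/
def chainPoint {m : ℕ} (g : Fin m → (𝓞 F)ˣ) (s : Equiv.Perm (Fin m)) (i : Fin (m + 1)) :
    (𝓞 F)ˣ :=
  ∏ l : Fin m, if (l : ℕ) < (i : ℕ) then g (s l) else 1

/-- The matrix whose rows are the vertices of the simplex `Σ(Δ_s)`, with the coordinates of
`ℝ^k`, `k = m + 1`, ordered by `e`. -/
noncomputable def vertexMatrix {m : ℕ} (e : Fin (m + 1) ≃ RealEmb F) (g : Fin m → (𝓞 F)ˣ)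
    (s : Equiv.Perm (Fin m)) : Matrix (Fin (m + 1)) (Fin (m + 1)) ℝ :=
  Matrix.of fun i j => sigmaMap ((chainPoint g s i : 𝓞 F) : F) (e j)

end CMField

/-- The matrix `B` of successive differences of the rows of `A`. -/
def diffMatrix {m : ℕ} (A : Matrix (Fin (m + 1)) (Fin (m + 1)) ℝ) :
    Matrix (Fin m) (Fin (m + 1)) ℝ :=
  Matrix.of fun i j => A i.succ j - A i.castSucc j

/-- The quantity `|(det A / k)^k ∏_l 1 / det B_l|`, `k = m + 1`, where `B_l` is `B` without its
`l`-th column. -/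
noncomputable def simplexBound {m : ℕ} (A : Matrix (Fin (m + 1)) (Fin (m + 1)) ℝ) : ℝ :=
  |(A.det / ((m + 1 : ℕ) : ℝ)) ^ (m + 1) *
    ∏ l : Fin (m + 1), 1 / ((diffMatrix A).submatrix id l.succAbove).det|

/-- The values of the simplex bound on the simplices `Σ(Δ_s)`, `s` a permutation of the
generators. -/
def boundValues {F : Type*} [Field F] [NumberField F] {m : ℕ} (e : Fin (m + 1) ≃ RealEmb F)
    (g : Fin m → (𝓞 F)ˣ) : Set ℝ :=
  Set.range fun s : Equiv.Perm (Fin m) => simplexBound (vertexMatrix e g s)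

/-- The cyclic shift `T` on `ℤ^{n+1}` (indices mod `n + 1`). -/
def cyclicShift (n : ℕ) : Module.End ℤ (Fin (n + 1) → ℤ) :=
  LinearMap.funLeft ℤ ℤ fun i => i - 1

theorem cyclicShift_single (n : ℕ) (j : Fin (n + 1)) :
    cyclicShift n (Pi.single j 1) = Pi.single (j + 1) 1 := by
  ext i
  simp [cyclicShift, LinearMap.funLeft_apply, Pi.single_apply, sub_eq_iff_eq_add]

/-- Craig's lattice `𝔸_n^{(r)}`, the image of `ℤ^{n+1}` under `(1 - T)^r`. -/
def craigLattice (n r : ℕ) : Submodule ℤ (Fin (n + 1) → ℤ) :=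
  LinearMap.range ((1 - cyclicShift n) ^ r)

/-- `v` is a shortest nonzero vector of the lattice `L` for the Euclidean length of `ℝ^d`. -/
def IsShortest {d : ℕ} (L : Submodule ℤ (Fin d → ℤ)) (v : Fin d → ℤ) : Prop :=
  v ∈ L ∧ v ≠ 0 ∧ ∀ w ∈ L, w ≠ 0 → ∑ i, v i ^ 2 ≤ ∑ i, w i ^ 2

/-- The element `∑ i, v_i ζ^i` attached to an integer vector `v`. -/
def evalAt {R : Type*} [CommRing R] (ζ : R) {d : ℕ} (v : Fin d → ℤ) : R :=
  ∑ i : Fin d, (v i : R) * ζ ^ (i : ℕ)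

end CraigLattice

/-!
Write `k` for the number of real embeddings of the maximal real subfield `K`, so that `k = 2` for
`n = 5` and `k = 3` for `n = 7`. Everything follows from comparing two estimates.

*Units are short.* Let `H` be the group of units generated by `ζ + ζ⁻¹` and, if `n = 7`, `ζ² + ζ⁻²`.
For positive weights `y`, a unit of `H` of least weighted norm exists (`exists_weightedNorm_le`), and
moving it into the weights one may assume that `1` is this unit. Comparison with a few elements of `H`
then gives linear inequalities between the weights, which confine them to a narrow cone around the
diagonal; on this cone `(∑ y)^k < (k + 1)^k ∏ y` (`isReducing_five`, `isReducing_seven`). The property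
is named `IsReducing`.

*Non-units are long.* A residue field of `𝓞 F` has at least `n` elements: the image of `ζ` in it
either has order `n` or equals `1`, and in the second case the characteristic is `n`. Hence a nonzero
non-unit `β` has norm at least `n` (`le_fieldNorm_of_not_isUnit`), and by the inequality of the
arithmetic and geometric mean its weighted norm satisfies `⟨β, β⟩_y ^ k ≥ k^k n ∏ y`.

Since `3^2 < 2^2 * 5` and `4^3 < 3^3 * 7`, every nonzero non-unit is longer than some unit, whatever
the weights. Scaling the weights by a generator of the ideal, the minimal vectors of a principal ideal
are the shortest unit multiples of the generator (`isMinimalVector_span_singleton_iff`); in particular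
their norm is the norm of the generator, which is stronger than the bounds by `5 / 4` and `56 / 27`.

The first estimate also yields the unit group. Take for weights the coordinates of a unit `w`: some
`u` in `H` makes the rational integer `Tr (w u * conj (w u))` less than `k + 1`. It is at least `k`,
with equality only if all conjugates of `w u` have absolute value `1`, so `w u` is a root of unity
(`mem_torsion_of_sum_lt`). Therefore `H` generates the units modulo torsion. The generators are
independent by the signs of the logarithms of their conjugates, and the simplex bounds are computed
from the minimal polynomial of `ζ + ζ⁻¹`.

For the Craig lattices, `2 ∑ σ(α ᾱ)` is the trace form, so that for `α = ∑ v_i ζ^i` it equals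
`n ∑ v_i^2 - (∑ v_i)^2` (`two_mul_weightedNorm_evalAt`). For `r ≥ 1` the coordinate sum vanishes on the
lattice and evaluation at `ζ` is a similarity onto the ideal of `(1 - ζ)^r`. For `r = 0` the lattice is
`ℤ^n`, evaluation is not injective, and the shortest vectors `± e_i` are matched with the roots of
unity `± ζ^i`.
-/

namespace CraigLattice

/-! ### Coordinates at the real embeddings -/

section CM

variable {F : Type*} [Field F] [NumberField F]

/-- A real embedding of the maximal real subfield extends to a complex embedding of `F`. -/
theorem exists_extension_realEmb (σ : RealEmb F) :
    ∃ φ : F →+* ℂ, ∀ x : maximalRealSubfield F, φ x = (σ x : ℂ) := by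
  let f : maximalRealSubfield F →+* ℂ := Complex.ofRealHom.comp σ
  let _ : Algebra (maximalRealSubfield F) ℂ := f.toAlgebra
  refine ⟨(IsAlgClosed.lift (S := F) (R := maximalRealSubfield F) (M := ℂ)).toRingHom, fun x => ?_⟩
  exact AlgHom.commutes (IsAlgClosed.lift (S := F) (R := maximalRealSubfield F) (M := ℂ)) x

theorem exists_realEmb_restrict (ψ : maximalRealSubfield F →+* ℂ) :
    ∃ σ : RealEmb F, ∀ x : maximalRealSubfield F, ψ x = (σ x : ℂ) := by
  have h : ComplexEmbedding.IsReal ψ := by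
    rw [← InfinitePlace.isReal_mk_iff]
    exact IsTotallyReal.isReal _
  exact ⟨h.embedding, fun x => (ComplexEmbedding.IsReal.coe_embedding_apply h x).symm⟩

/-- The maximal real subfield is totally real: its real embeddings are its complex embeddings. -/
noncomputable def realEmbEquiv : RealEmb F ≃ (maximalRealSubfield F →ₐ[ℚ] ℂ) :=
  Equiv.ofBijective (fun σ => (Complex.ofRealHom.comp σ).toRatAlgHom) (by
    constructor
    · intro σ τ h
      ext x
      have := DFunLike.congr_fun h x
      simpa using this
    · intro ψ
      obtain ⟨σ, hσ⟩ := exists_realEmb_restrict (ψ : maximalRealSubfield F →+* ℂ)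
      refine ⟨σ, ?_⟩
      ext x
      simpa using (hσ x).symm)

@[simp]
theorem realEmbEquiv_apply (σ : RealEmb F) (x : maximalRealSubfield F) :
    realEmbEquiv σ x = (σ x : ℂ) := rfl

theorem sum_realEmb (x : maximalRealSubfield F) :
    ∑ σ : RealEmb F, σ x = (Algebra.trace ℚ (maximalRealSubfield F) x : ℝ) := by
  have h := trace_eq_sum_embeddings (K := ℚ) (L := maximalRealSubfield F) ℂ (x := x)
  rw [← (realEmbEquiv (F := F)).sum_comp] at h
  simp only [realEmbEquiv_apply, eq_ratCast] at h
  exact_mod_cast h.symm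

theorem prod_realEmb (x : maximalRealSubfield F) :
    ∏ σ : RealEmb F, σ x = (Algebra.norm ℚ x : ℝ) := by
  have h := Algebra.norm_eq_prod_embeddings (K := ℚ) (L := maximalRealSubfield F) ℂ x
  rw [← (realEmbEquiv (F := F)).prod_comp] at h
  simp only [realEmbEquiv_apply, eq_ratCast] at h
  exact_mod_cast h.symm

theorem card_realEmb : Fintype.card (RealEmb F) = Module.finrank ℚ (maximalRealSubfield F) := by
  rw [Fintype.card_congr (realEmbEquiv (F := F)), ← Nat.card_eq_fintype_card,
    ← Field.finSepDegree_eq_finrank_of_isSeparable ℚ (maximalRealSubfield F),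
    Field.finSepDegree_eq_of_isAlgClosed ℚ _ ℂ]

omit [NumberField F] in
theorem sigmaMap_mul (α β : F) (σ : RealEmb F) :
    sigmaMap (α * β) σ = sigmaMap α σ * sigmaMap β σ := by
  simp [sigmaMap]

omit [NumberField F] in
@[simp]
theorem sigmaMap_one (σ : RealEmb F) : sigmaMap (1 : F) σ = 1 := by
  simp [sigmaMap]

omit [NumberField F] in
theorem sigmaMap_units_mul (u v : (𝓞 F)ˣ) (σ : RealEmb F) :
    sigmaMap ((u * v : (𝓞 F)ˣ) : F) σ = sigmaMap (u : F) σ * sigmaMap (v : F) σ := by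
  simp [sigmaMap]

/-- `u ↦ σ(u ū)` as a homomorphism on the unit group. -/
noncomputable def sigmaHom (σ : RealEmb F) : (𝓞 F)ˣ →* ℝ where
  toFun u := sigmaMap (u : F) σ
  map_one' := by simp
  map_mul' u v := sigmaMap_units_mul u v σ

omit [NumberField F] in
theorem sigmaMap_units_zpow (u : (𝓞 F)ˣ) (a : ℤ) (σ : RealEmb F) :
    sigmaMap ((u ^ a : (𝓞 F)ˣ) : F) σ = sigmaMap (u : F) σ ^ a := by
  have := congrArg Units.val (map_zpow (sigmaHom σ).toHomUnits u a)
  rwa [Units.val_zpow_eq_zpow_val] at this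

omit [NumberField F] in
theorem sigmaMap_units_inv (u : (𝓞 F)ˣ) (σ : RealEmb F) :
    sigmaMap ((u⁻¹ : (𝓞 F)ˣ) : F) σ = (sigmaMap (u : F) σ)⁻¹ := by
  simpa using sigmaMap_units_zpow u (-1) σ

theorem fieldNorm_eq_norm (α : F) : fieldNorm α = (Algebra.norm ℚ α : ℝ) := by
  rw [fieldNorm, ← Algebra.norm_norm (R := ℚ) (S := maximalRealSubfield F), ← prod_realEmb]
  rfl

theorem fieldNorm_mul (α β : F) : fieldNorm (α * β) = fieldNorm α * fieldNorm β := by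
  simp [fieldNorm_eq_norm]

/-- The trace of the algebraic integer `α ᾱ` of the maximal real subfield is a rational integer. -/
theorem exists_int_sum_sigmaMap (α : 𝓞 F) :
    ∃ z : ℤ, ∑ σ : RealEmb F, sigmaMap (α : F) σ = z := by
  have hint : IsIntegral ℤ (Algebra.norm (maximalRealSubfield F) (α : F)) :=
    Algebra.isIntegral_norm _ α.2
  obtain ⟨z, hz⟩ := IsIntegrallyClosed.isIntegral_iff.1
    (Algebra.isIntegral_trace (L := ℚ) hint)
  refine ⟨z, ?_⟩
  have h := sum_realEmb (Algebra.norm (maximalRealSubfield F) (α : F))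
  rw [← hz] at h
  simpa [sigmaMap] using h

variable [IsCMField F]

theorem sigmaMap_eq_norm_sq {σ : RealEmb F} {φ : F →+* ℂ}
    (h : ∀ x : maximalRealSubfield F, φ x = (σ x : ℂ)) (α : F) :
    sigmaMap α σ = ‖φ α‖ ^ 2 := by
  have h1 := h (Algebra.norm (maximalRealSubfield F) α)
  rw [norm_eq_mul_complexConj, map_mul, IsCMField.complexEmbedding_complexConj,
    Complex.mul_conj, Complex.normSq_eq_norm_sq] at h1
  exact_mod_cast h1.symm

theorem sigmaMap_pos {α : F} (hα : α ≠ 0) (σ : RealEmb F) : 0 < sigmaMap α σ := by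
  obtain ⟨φ, hφ⟩ := exists_extension_realEmb σ
  rw [sigmaMap_eq_norm_sq hφ]
  have := (map_ne_zero φ).2 hα
  positivity

theorem sigmaMap_unit_pos (u : (𝓞 F)ˣ) (σ : RealEmb F) : 0 < sigmaMap (u : F) σ :=
  sigmaMap_pos (Units.coe_ne_zero u) σ

theorem fieldNorm_eq_absNorm (α : 𝓞 F) :
    fieldNorm (α : F) = (Ideal.absNorm (Ideal.span {α}) : ℝ) := by
  have h0 : (0 : ℝ) ≤ fieldNorm (α : F) := by
    by_cases h : (α : F) = 0
    · rw [fieldNorm_eq_norm, h, Algebra.norm_zero]; simp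
    · exact Finset.prod_nonneg fun σ _ => (sigmaMap_pos h σ).le
  rw [← abs_of_nonneg h0, fieldNorm_eq_norm, Ideal.absNorm_span_singleton, ← Algebra.coe_norm_int]
  simp

theorem one_le_fieldNorm {α : 𝓞 F} (hα : α ≠ 0) : 1 ≤ fieldNorm (α : F) := by
  rw [fieldNorm_eq_absNorm, Nat.one_le_cast, Nat.one_le_iff_ne_zero, Ne,
    Ideal.absNorm_eq_zero_iff, Ideal.span_singleton_eq_bot]
  exact hα

@[simp]
theorem fieldNorm_unit (u : (𝓞 F)ˣ) : fieldNorm (u : F) = 1 := by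
  rw [fieldNorm_eq_absNorm, Ideal.span_singleton_eq_top.2 u.isUnit, Ideal.absNorm_top, Nat.cast_one]

theorem mem_torsion_iff_sigmaMap {u : (𝓞 F)ˣ} :
    u ∈ Units.torsion F ↔ ∀ σ : RealEmb F, sigmaMap (u : F) σ = 1 := by
  rw [Units.mem_torsion, InfinitePlace.eq_iff_eq]
  constructor
  · intro h σ
    obtain ⟨φ, hφ⟩ := exists_extension_realEmb σ
    rw [sigmaMap_eq_norm_sq hφ, h φ, one_pow]
  · intro h φ
    obtain ⟨σ, hσ⟩ := exists_realEmb_restrict (φ.comp (algebraMap (maximalRealSubfield F) F))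
    have := h σ
    rw [sigmaMap_eq_norm_sq (φ := φ) hσ] at this
    exact (pow_eq_one_iff_of_nonneg (norm_nonneg _) two_ne_zero).1 this

/-- `2 ∑ σ(α ᾱ)` is the trace form of `F`. -/
theorem two_mul_sum_sigmaMap (α : F) :
    2 * ∑ σ : RealEmb F, sigmaMap α σ =
      (Algebra.trace ℚ F (α * IsCMField.complexConj F α) : ℝ) := by
  have h2 : Module.finrank (maximalRealSubfield F) F = 2 :=
    Algebra.IsQuadraticExtension.finrank_eq_two _ _
  rw [← norm_eq_mul_complexConj, ← Algebra.trace_trace (S := maximalRealSubfield F)]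
  have := Algebra.trace_algebraMap (R := maximalRealSubfield F) (S := F)
    (Algebra.norm (maximalRealSubfield F) α)
  change Algebra.trace (maximalRealSubfield F) F (Algebra.norm (maximalRealSubfield F) α : F) = _
    at this
  rw [this, h2, map_nsmul]
  have h := sum_realEmb (Algebra.norm (maximalRealSubfield F) α)
  simp only [sigmaMap, h]
  simp

theorem finrank_eq_two_mul_card : Module.finrank ℚ F = 2 * Fintype.card (RealEmb F) := by
  have h2 : Module.finrank (maximalRealSubfield F) F = 2 :=
    Algebra.IsQuadraticExtension.finrank_eq_two _ _
  rw [card_realEmb, ← Module.finrank_mul_finrank ℚ (maximalRealSubfield F) F, h2, mul_comm]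

end CM

/-! ### Reducing unit groups and minimal vectors -/

theorem card_pow_mul_prod_le_sum_pow {ι : Type*} [Fintype ι] [Nonempty ι] (z : ι → ℝ)
    (hz : ∀ i, 0 ≤ z i) :
    (Fintype.card ι : ℝ) ^ Fintype.card ι * ∏ i, z i ≤ (∑ i, z i) ^ Fintype.card ι := by
  have hk : (0 : ℝ) < Fintype.card ι := by exact_mod_cast Fintype.card_pos
  have h := Real.geom_mean_le_arith_mean Finset.univ (fun _ => 1) z (by simp) (by simpa using hk)
    (fun i _ => hz i)
  simp only [Real.rpow_one, Finset.sum_const, Finset.card_univ, nsmul_eq_mul, mul_one,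
    one_mul] at h
  have hp : 0 ≤ ∏ i, z i := Finset.prod_nonneg fun i _ => hz i
  have h2 := pow_le_pow_left₀ (by positivity) h (Fintype.card ι)
  rw [Real.rpow_inv_natCast_pow hp Fintype.card_ne_zero, div_pow, le_div_iff₀ (by positivity)] at h2
  linarith

theorem card_le_sum_of_one_le_prod {ι : Type*} [Fintype ι] (z : ι → ℝ) (hz : ∀ i, 0 < z i)
    (hp : 1 ≤ ∏ i, z i) : (Fintype.card ι : ℝ) ≤ ∑ i, z i := by
  have h1 : 0 ≤ ∑ i, Real.log (z i) := by
    rw [← Real.log_prod fun i _ => (hz i).ne']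
    exact Real.log_nonneg hp
  have h2 : ∑ i, Real.log (z i) ≤ ∑ i, (z i - 1) :=
    Finset.sum_le_sum fun i _ => Real.log_le_sub_one_of_pos (hz i)
  rw [Finset.sum_sub_distrib] at h2
  simp only [Finset.sum_const, Finset.card_univ, nsmul_eq_mul, mul_one] at h2
  linarith

/-- The equality case of the arithmetic-geometric mean inequality. -/
theorem eq_one_of_prod_eq_one_of_sum_le_card {ι : Type*} [Fintype ι] (z : ι → ℝ)
    (hz : ∀ i, 0 < z i) (hp : ∏ i, z i = 1) (hs : ∑ i, z i ≤ Fintype.card ι) (i : ι) :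
    z i = 1 := by
  have h1 : ∑ i, Real.log (z i) = 0 := by
    rw [← Real.log_prod fun i _ => (hz i).ne', hp, Real.log_one]
  have hnn : ∀ j ∈ Finset.univ, 0 ≤ z j - 1 - Real.log (z j) := fun j _ => by
    linarith [Real.log_le_sub_one_of_pos (hz j)]
  have h2 : ∑ j, (z j - 1 - Real.log (z j)) = 0 := by
    refine le_antisymm ?_ (Finset.sum_nonneg hnn)
    rw [Finset.sum_sub_distrib, Finset.sum_sub_distrib, h1]
    simp only [Finset.sum_const, Finset.card_univ, nsmul_eq_mul, mul_one]
    linarith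
  have h3 := (Finset.sum_eq_zero_iff_of_nonneg hnn).1 h2 i (Finset.mem_univ i)
  by_contra hne
  linarith [Real.log_lt_sub_one_of_pos (hz i) hne]

section CM

variable {F : Type*} [Field F] [NumberField F]

theorem weightedNorm_mul (x : RealEmb F → ℝ) (α β : F) :
    weightedNorm x (α * β) = weightedNorm (fun σ => x σ * sigmaMap α σ) β := by
  simp only [weightedNorm, sigmaMap_mul, mul_assoc]

variable [IsCMField F]

instance : Nonempty (RealEmb F) := by
  rw [← Fintype.card_pos_iff]
  have h := finrank_eq_two_mul_card (F := F)
  have := Module.finrank_pos (R := ℚ) (M := F)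
  omega

/-- Only finitely many algebraic integers have bounded conjugates, so a weighted norm attains its
minimum on a set of units. -/
theorem exists_weightedNorm_le (H : Subgroup (𝓞 F)ˣ) {y : RealEmb F → ℝ} (hy : ∀ σ, 0 < y σ) :
    ∃ u ∈ H, ∀ v ∈ H, weightedNorm y (u : F) ≤ weightedNorm y (v : F) := by
  set M := weightedNorm y (1 : F)
  obtain ⟨σ₀, hσ₀⟩ := Finite.exists_min y
  have hterm : ∀ (u : (𝓞 F)ˣ) σ, 0 ≤ y σ * sigmaMap (u : F) σ := fun u σ =>
    (mul_pos (hy σ) (sigmaMap_unit_pos u σ)).le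
  have hfin : {u : (𝓞 F)ˣ | u ∈ H ∧ weightedNorm y (u : F) ≤ M}.Finite := by
    refine Set.Finite.of_finite_image (f := fun u : (𝓞 F)ˣ => (u : F))
      ((Embeddings.finite_of_norm_le F ℂ (M / y σ₀ + 1)).subset ?_)
      (Units.coe_injective F).injOn
    rintro _ ⟨u, ⟨-, hu⟩, rfl⟩
    refine ⟨(u : 𝓞 F).isIntegral_coe, fun φ => ?_⟩
    obtain ⟨σ, hσ⟩ := exists_realEmb_restrict (φ.comp (algebraMap (maximalRealSubfield F) F))
    have h1 : y σ * sigmaMap (u : F) σ ≤ M :=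
      (Finset.single_le_sum (fun τ _ => hterm u τ) (Finset.mem_univ σ)).trans hu
    have h2 : sigmaMap (u : F) σ ≤ M / y σ₀ := by
      rw [le_div_iff₀ (hy σ₀)]
      nlinarith [hσ₀ σ, sigmaMap_unit_pos u σ]
    rw [sigmaMap_eq_norm_sq (φ := φ) hσ] at h2
    nlinarith [norm_nonneg (φ u), sq_nonneg (‖φ u‖ - 1)]
  obtain ⟨u, ⟨huH, huM⟩, hmin⟩ := Set.exists_min_image _ (fun u : (𝓞 F)ˣ => weightedNorm y (u : F))
    hfin ⟨1, H.one_mem, by simp [M]⟩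
  refine ⟨u, huH, fun v hv => ?_⟩
  by_cases h : weightedNorm y (v : F) ≤ M
  · exact hmin v ⟨hv, h⟩
  · exact huM.trans (not_le.1 h).le

/-- The subgroup `H` of the unit group is *reducing* if, for all positive weights, some unit in `H`
has weighted norm less than `(k + 1) (∏ y)^{1/k}`, where `k` is the number of real embeddings of the
maximal real subfield. The least possible value would be `k (∏ y)^{1/k}`. -/
def IsReducing (H : Subgroup (𝓞 F)ˣ) : Prop :=
  ∀ y : RealEmb F → ℝ, (∀ σ, 0 < y σ) → ∃ u ∈ H,
    weightedNorm y (u : F) ^ Fintype.card (RealEmb F) <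
      ((Fintype.card (RealEmb F) : ℝ) + 1) ^ Fintype.card (RealEmb F) * ∏ σ, y σ

/-- It suffices to reduce the weights that admit no further reduction by the elements of `H`. -/
theorem isReducing_of_reduced {H : Subgroup (𝓞 F)ˣ}
    (h : ∀ y : RealEmb F → ℝ, (∀ σ, 0 < y σ) →
      (∀ v ∈ H, ∑ σ, y σ ≤ ∑ σ, y σ * sigmaMap (v : F) σ) →
      (∑ σ, y σ) ^ Fintype.card (RealEmb F) <
        ((Fintype.card (RealEmb F) : ℝ) + 1) ^ Fintype.card (RealEmb F) * ∏ σ, y σ) :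
    IsReducing H := by
  intro y hy
  obtain ⟨u, hu, hmin⟩ := exists_weightedNorm_le H hy
  refine ⟨u, hu, ?_⟩
  have h1 := h (fun σ => y σ * sigmaMap (u : F) σ)
    (fun σ => mul_pos (hy σ) (sigmaMap_unit_pos u σ)) (fun v hv => by
      have := hmin (u * v) (H.mul_mem hu hv)
      simpa [weightedNorm, sigmaMap_mul, mul_assoc] using this)
  rw [Finset.prod_mul_distrib] at h1
  have h2 : ∏ σ : RealEmb F, sigmaMap (u : F) σ = 1 := fieldNorm_unit u
  rwa [h2, mul_one] at h1

/-- The trace of `u ū` is an integer, at least `k`, with equality only for roots of unity. -/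
theorem mem_torsion_of_sum_lt {u : (𝓞 F)ˣ}
    (h : ∑ σ : RealEmb F, sigmaMap (u : F) σ < Fintype.card (RealEmb F) + 1) :
    u ∈ Units.torsion F := by
  rw [mem_torsion_iff_sigmaMap]
  obtain ⟨z, hz⟩ := exists_int_sum_sigmaMap (u : 𝓞 F)
  refine eq_one_of_prod_eq_one_of_sum_le_card _ (sigmaMap_unit_pos u) (fieldNorm_unit u) ?_
  rw [hz] at h ⊢
  have : z < (Fintype.card (RealEmb F) : ℤ) + 1 := by exact_mod_cast h
  have h3 : z ≤ (Fintype.card (RealEmb F) : ℤ) := by omega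
  exact_mod_cast h3

theorem IsReducing.exists_eq_torsion_mul {H : Subgroup (𝓞 F)ˣ} (hH : IsReducing H) (w : (𝓞 F)ˣ) :
    ∃ t ∈ Units.torsion F, ∃ u ∈ H, w = t * u := by
  obtain ⟨u, hu, hlt⟩ := hH (fun σ => sigmaMap (w : F) σ) (sigmaMap_unit_pos w)
  have h2 : ∏ σ : RealEmb F, sigmaMap (w : F) σ = 1 := fieldNorm_unit w
  rw [h2, mul_one] at hlt
  refine ⟨w * u, mem_torsion_of_sum_lt ?_, u⁻¹, H.inv_mem hu, by simp⟩
  have := lt_of_pow_lt_pow_left₀ _ (by positivity) hlt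
  simpa [weightedNorm, sigmaMap_mul] using this

theorem IsReducing.exists_weightedNorm_lt {H : Subgroup (𝓞 F)ˣ} (hH : IsReducing H) {c : ℝ}
    (hc : ((Fintype.card (RealEmb F) : ℝ) + 1) ^ Fintype.card (RealEmb F) ≤
      (Fintype.card (RealEmb F) : ℝ) ^ Fintype.card (RealEmb F) * c)
    {y : RealEmb F → ℝ} (hy : ∀ σ, 0 < y σ) {β : F} (hβ : β ≠ 0) (hn : c ≤ fieldNorm β) :
    ∃ u : (𝓞 F)ˣ, weightedNorm y (u : F) < weightedNorm y β := by
  obtain ⟨u, -, hu⟩ := hH y hy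
  refine ⟨u, lt_of_pow_lt_pow_left₀ (Fintype.card (RealEmb F))
    (Finset.sum_nonneg fun σ _ => (mul_pos (hy σ) (sigmaMap_pos hβ σ)).le) ?_⟩
  have h1 := card_pow_mul_prod_le_sum_pow (fun σ : RealEmb F => y σ * sigmaMap β σ)
    (fun σ => (mul_pos (hy σ) (sigmaMap_pos hβ σ)).le)
  rw [Finset.prod_mul_distrib] at h1
  change _ * (_ * fieldNorm β) ≤ weightedNorm y β ^ _ at h1
  have hp : 0 < ∏ σ, y σ := Finset.prod_pos fun σ _ => hy σ
  set k := Fintype.card (RealEmb F)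
  calc _ < ((k : ℝ) + 1) ^ k * ∏ σ, y σ := hu
    _ ≤ (k : ℝ) ^ k * c * ∏ σ, y σ := by gcongr
    _ ≤ (k : ℝ) ^ k * fieldNorm β * ∏ σ, y σ := by gcongr
    _ ≤ _ := by linarith

/-- If every nonzero non-unit is longer than some unit, for all weights, then the minimal vectors of
a principal ideal are the shortest unit multiples of its generator. -/
theorem isMinimalVector_span_singleton_iff
    (hlt : ∀ y : RealEmb F → ℝ, (∀ σ, 0 < y σ) → ∀ β : 𝓞 F, β ≠ 0 → ¬ IsUnit β →
      ∃ u : (𝓞 F)ˣ, weightedNorm y (u : F) < weightedNorm y (β : F))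
    {π : 𝓞 F} (hπ : π ≠ 0) {x : RealEmb F → ℝ} (hx : ∀ σ, 0 < x σ) (α : 𝓞 F) :
    IsMinimalVector (Ideal.span {π}) x α ↔ ∃ u : (𝓞 F)ˣ, α = π * u ∧
      ∀ u' : (𝓞 F)ˣ, weightedNorm x ((π * u : 𝓞 F) : F) ≤ weightedNorm x ((π * u' : 𝓞 F) : F) := by
  have hlt' : ∀ β : 𝓞 F, β ≠ 0 → ¬ IsUnit β → ∃ u : (𝓞 F)ˣ,
      weightedNorm x ((π * u : 𝓞 F) : F) < weightedNorm x ((π * β : 𝓞 F) : F) := by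
    intro β h0 hu
    have hπ' : (π : F) ≠ 0 := by simpa using hπ
    obtain ⟨u, hu⟩ := hlt (fun σ => x σ * sigmaMap (π : F) σ)
      (fun σ => mul_pos (hx σ) (sigmaMap_pos hπ' σ)) β h0 hu
    exact ⟨u, by simpa only [map_mul, weightedNorm_mul] using hu⟩
  have hmem : ∀ u : (𝓞 F)ˣ, π * u ∈ Ideal.span {π} ∧ π * (u : 𝓞 F) ≠ 0 := fun u =>
    ⟨Ideal.mem_span_singleton.2 (dvd_mul_right _ _), mul_ne_zero hπ u.ne_zero⟩
  constructor
  · rintro ⟨hα, h0, hmin⟩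
    obtain ⟨β, rfl⟩ := Ideal.mem_span_singleton.1 hα
    by_cases hβ : IsUnit β
    · obtain ⟨u, rfl⟩ := hβ
      exact ⟨u, rfl, fun u' => hmin _ (hmem u').1 (hmem u').2⟩
    · obtain ⟨u, hu⟩ := hlt' β (right_ne_zero_of_mul h0) hβ
      exact absurd (hmin _ (hmem u).1 (hmem u).2) (not_le.2 hu)
  · rintro ⟨u, rfl, hmin⟩
    refine ⟨(hmem u).1, (hmem u).2, fun β hβ h0 => ?_⟩
    obtain ⟨γ, rfl⟩ := Ideal.mem_span_singleton.1 hβ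
    by_cases hγ : IsUnit γ
    · obtain ⟨u', rfl⟩ := hγ
      exact hmin u'
    · obtain ⟨u', hu'⟩ := hlt' γ (right_ne_zero_of_mul h0) hγ
      exact (hmin u').trans hu'.le

/-- A generator of a principal ideal is a minimal vector for the weights `1 / σ(α ᾱ)`. -/
theorem exists_isMinimalVector_span_singleton {α : 𝓞 F} (hα : α ≠ 0) :
    ∃ x : RealEmb F → ℝ, (∀ σ, 0 < x σ) ∧ IsMinimalVector (Ideal.span {α}) x α := by
  have hα' : (α : F) ≠ 0 := by simpa using hα
  refine ⟨fun σ => (sigmaMap (α : F) σ)⁻¹, fun σ => inv_pos.2 (sigmaMap_pos hα' σ),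
    Ideal.mem_span_singleton_self α, hα, fun β hβ h0 => ?_⟩
  obtain ⟨γ, rfl⟩ := Ideal.mem_span_singleton.1 hβ
  have hγ : γ ≠ 0 := right_ne_zero_of_mul h0
  have hγ' : (γ : F) ≠ 0 := by simpa using hγ
  have h1 : ∀ σ : RealEmb F, (sigmaMap (α : F) σ)⁻¹ * sigmaMap (α : F) σ = 1 := fun σ =>
    inv_mul_cancel₀ (sigmaMap_pos hα' σ).ne'
  simp only [map_mul, weightedNorm, sigmaMap_mul, ← mul_assoc, h1, one_mul]
  simpa using card_le_sum_of_one_le_prod _ (sigmaMap_pos hγ') (one_le_fieldNorm hγ)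

end CM

/-! ### Norms of non-units -/

section CM

variable {F : Type*} [Field F] [NumberField F]

/-- In a residue field of `𝓞 F` the image of `ζ` is either an element of order `n`, or `1`, and then
the field has characteristic `n`; so the residue field has at least `n` elements. -/
theorem le_absNorm_of_isMaximal {n : ℕ} (hn : n.Prime) {ζ : 𝓞 F} (hζ : IsPrimitiveRoot ζ n)
    (P : Ideal (𝓞 F)) [P.IsMaximal] (hP : P ≠ ⊥) : n ≤ Ideal.absNorm P := by
  have := Fact.mk hn
  have hfin : Finite (𝓞 F ⧸ P) := Ideal.finiteQuotientOfFreeOfNeBot P hP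
  let _ : Field (𝓞 F ⧸ P) := Ideal.Quotient.field P
  have hcard : Ideal.absNorm P = Nat.card (𝓞 F ⧸ P) := by
    rw [Ideal.absNorm_apply, Submodule.cardQuot_apply]
  rw [hcard]
  set z := Ideal.Quotient.mk P ζ with hz
  have hzn : z ^ n = 1 := by rw [hz, ← map_pow, hζ.pow_eq_one, map_one]
  by_cases h1 : z = 1
  · have hsum : (n : 𝓞 F ⧸ P) = 0 := by
      have := congrArg (Ideal.Quotient.mk P) (hζ.geom_sum_eq_zero hn.one_lt)
      simpa [map_sum, ← hz, h1] using this
    have hord : addOrderOf (1 : 𝓞 F ⧸ P) = n :=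
      addOrderOf_eq_prime (by simpa using hsum) one_ne_zero
    rw [← hord]
    exact addOrderOf_le_card
  · rw [← orderOf_eq_prime hzn h1]
    exact orderOf_le_card

theorem le_fieldNorm_of_not_isUnit [IsCMField F] {n : ℕ} (hn : n.Prime) {ζ : 𝓞 F}
    (hζ : IsPrimitiveRoot ζ n) {β : 𝓞 F} (h0 : β ≠ 0) (hβ : ¬ IsUnit β) :
    (n : ℝ) ≤ fieldNorm (β : F) := by
  obtain ⟨P, hP, hmem⟩ := exists_max_ideal_of_mem_nonunits hβ
  have hle : Ideal.span {β} ≤ P := by simpa [Ideal.span_singleton_le_iff_mem] using hmem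
  have hbot : Ideal.span {β} ≠ ⊥ := by simpa using h0
  have hPbot : P ≠ ⊥ := fun h => hbot (le_bot_iff.1 (h ▸ hle))
  rw [fieldNorm_eq_absNorm, Nat.cast_le]
  exact (le_absNorm_of_isMaximal hn hζ P hPbot).trans <|
    Nat.le_of_dvd (Nat.pos_of_ne_zero (mt Ideal.absNorm_eq_zero_iff.1 hbot))
      (Ideal.absNorm_dvd_absNorm_of_le hle)

end CM

/-! ### Evaluation of integer vectors at a root of unity -/

section Eval

theorem evalAt_add {R : Type*} [CommRing R] (ζ : R) {d : ℕ} (v w : Fin d → ℤ) :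
    evalAt ζ (v + w) = evalAt ζ v + evalAt ζ w := by
  simp [evalAt, add_mul, Finset.sum_add_distrib]

/-- `v ↦ ∑ i, v_i ζ^i` as an additive map. -/
def evalAddHom {R : Type*} [CommRing R] (ζ : R) (d : ℕ) : (Fin d → ℤ) →+ R where
  toFun := evalAt ζ
  map_zero' := by simp [evalAt]
  map_add' := evalAt_add ζ

theorem evalAt_sub {R : Type*} [CommRing R] (ζ : R) {d : ℕ} (v w : Fin d → ℤ) :
    evalAt ζ (v - w) = evalAt ζ v - evalAt ζ w :=
  map_sub (evalAddHom ζ d) v w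

theorem evalAt_neg {R : Type*} [CommRing R] (ζ : R) {d : ℕ} (v : Fin d → ℤ) :
    evalAt ζ (-v) = -evalAt ζ v :=
  map_neg (evalAddHom ζ d) v

theorem evalAt_single {R : Type*} [CommRing R] (ζ : R) {d : ℕ} (i : Fin d) :
    evalAt ζ (Pi.single i 1) = ζ ^ (i : ℕ) := by
  simp [evalAt, Pi.single_apply, ite_mul]

variable {R : Type*} [CommRing R] {ζ : R} {m : ℕ}

theorem pow_val_add_one (hζ : ζ ^ (m + 1) = 1) (j : Fin (m + 1)) :
    ζ ^ ((j + 1 : Fin (m + 1)) : ℕ) = ζ * ζ ^ (j : ℕ) := by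
  rcases m with _ | m
  · have : ζ = 1 := by simpa using hζ
    simp [this]
  · rw [Fin.val_add_one]
    split_ifs with h
    · rw [h, ← pow_succ', Fin.val_last, hζ, pow_zero]
    · rw [pow_succ']

theorem evalAt_cyclicShift (hζ : ζ ^ (m + 1) = 1) (v : Fin (m + 1) → ℤ) :
    evalAt ζ (cyclicShift m v) = ζ * evalAt ζ v := by
  rw [evalAt, evalAt, ← Equiv.sum_comp (Equiv.addRight (1 : Fin (m + 1)))
    fun i => (cyclicShift m v i : R) * ζ ^ (i : ℕ), Finset.mul_sum]
  refine Finset.sum_congr rfl fun j _ => ?_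
  simp only [cyclicShift, LinearMap.funLeft_apply, Equiv.coe_addRight, add_sub_cancel_right,
    pow_val_add_one hζ]
  ring

theorem evalAt_one_sub_cyclicShift_pow (hζ : ζ ^ (m + 1) = 1) (r : ℕ) (v : Fin (m + 1) → ℤ) :
    evalAt ζ (((1 - cyclicShift m) ^ r) v) = (1 - ζ) ^ r * evalAt ζ v := by
  induction r with
  | zero => simp
  | succ r ih =>
    rw [pow_succ', Module.End.mul_apply, LinearMap.sub_apply, Module.End.one_apply, evalAt_sub,
      evalAt_cyclicShift hζ, ih]
    ring

theorem sum_cyclicShift (v : Fin (m + 1) → ℤ) : ∑ i, cyclicShift m v i = ∑ i, v i :=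
  (Equiv.subRight (1 : Fin (m + 1))).sum_comp v

theorem sum_eq_zero_of_mem_craigLattice {r : ℕ} (hr : r ≠ 0) {v : Fin (m + 1) → ℤ}
    (hv : v ∈ craigLattice m r) : ∑ i, v i = 0 := by
  obtain ⟨r, rfl⟩ := Nat.exists_eq_succ_of_ne_zero hr
  obtain ⟨w, rfl⟩ := hv
  rw [Nat.succ_eq_add_one, pow_succ', Module.End.mul_apply, LinearMap.sub_apply,
    Module.End.one_apply]
  simp [Finset.sum_sub_distrib, sum_cyclicShift]

end Eval

section Cyclotomic

variable {F : Type*} [Field F] [NumberField F] {m : ℕ} [IsCyclotomicExtension {m + 1} ℚ F]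
  {ζ : 𝓞 F}

theorem evalAt_surjective (hζ : IsPrimitiveRoot ζ (m + 1)) :
    Function.Surjective (evalAt ζ : (Fin (m + 1) → ℤ) → 𝓞 F) := by
  have hζF : IsPrimitiveRoot (ζ : F) (m + 1) :=
    hζ.map_of_injective RingOfIntegers.coe_injective
  have hmul : ∀ (k : ℕ) (v : Fin (m + 1) → ℤ), ∃ w : Fin (m + 1) → ℤ,
      evalAt ζ w = ζ ^ k * evalAt ζ v := by
    intro k v
    induction k with
    | zero => exact ⟨v, by simp⟩
    | succ k ih =>
      obtain ⟨w, hw⟩ := ih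
      exact ⟨cyclicShift m w, by rw [evalAt_cyclicShift hζ.pow_eq_one, hw]; ring⟩
  intro α
  have hα : α ∈ Algebra.adjoin ℤ {ζ} := by
    have h := IsCyclotomicExtension.Rat.adjoin_singleton_eq_top hζF
    have h2 : hζF.toInteger = ζ := by ext; rfl
    rw [← h2, h]
    trivial
  rw [Algebra.adjoin_singleton_eq_range_aeval] at hα
  obtain ⟨p, rfl⟩ := hα
  change Polynomial.aeval ζ p ∈ Set.range (evalAddHom ζ (m + 1))
  rw [Polynomial.aeval_eq_sum_range, ← AddMonoidHom.coe_range]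
  refine sum_mem fun k _ => zsmul_mem ?_ _
  obtain ⟨w, hw⟩ := hmul k (Pi.single 0 1)
  exact ⟨w, by simpa [evalAt_single] using! hw⟩

theorem image_craigLattice (hζ : IsPrimitiveRoot ζ (m + 1)) (r : ℕ) :
    evalAt ζ '' (craigLattice m r : Set (Fin (m + 1) → ℤ)) = Ideal.span {(1 - ζ) ^ r} := by
  ext α
  simp only [Set.mem_image, SetLike.mem_coe, Ideal.mem_span_singleton, craigLattice,
    LinearMap.mem_range]
  constructor
  · rintro ⟨_, ⟨w, rfl⟩, rfl⟩
    rw [evalAt_one_sub_cyclicShift_pow hζ.pow_eq_one]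
    exact dvd_mul_right _ _
  · rintro ⟨β, rfl⟩
    obtain ⟨w, rfl⟩ := evalAt_surjective hζ β
    exact ⟨_, ⟨w, rfl⟩, evalAt_one_sub_cyclicShift_pow hζ.pow_eq_one r w⟩

theorem trace_primitiveRoot (hp : (m + 1).Prime) {ξ : F} (hξ : IsPrimitiveRoot ξ (m + 1)) :
    Algebra.trace ℚ F ξ = -1 := by
  have := Fact.mk hp
  have h := (hξ.powerBasis ℚ).trace_gen_eq_nextCoeff_minpoly
  rw [hξ.powerBasis_gen ℚ, ← Polynomial.cyclotomic_eq_minpoly_rat hξ m.succ_pos] at h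
  have hm : 1 ≤ m := by have := hp.two_le; omega
  have hdeg : (Polynomial.cyclotomic (m + 1) ℚ).natDegree = m := by
    rw [Polynomial.natDegree_cyclotomic, Nat.totient_prime hp, Nat.add_sub_cancel]
  rw [h, Polynomial.nextCoeff_of_natDegree_pos (by omega), hdeg, Polynomial.cyclotomic_prime,
    Polynomial.finsetSum_coeff]
  simp [Polynomial.coeff_X_pow]

variable [IsCMField F]

theorem mul_complexConj_primitiveRoot {n : ℕ} (hn : n ≠ 0) {ξ : F} (hξ : ξ ^ n = 1) :
    ξ * IsCMField.complexConj F ξ = 1 := by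
  let φ : F →+* ℂ := Classical.choice inferInstance
  apply φ.injective
  have h : ‖φ ξ‖ = 1 := Complex.norm_eq_one_of_pow_eq_one (by rw [← map_pow, hξ, map_one]) hn
  rw [map_mul, IsCMField.complexEmbedding_complexConj, Complex.mul_conj, Complex.normSq_eq_norm_sq,
    h]
  simp

/-- The Euclidean length of an integer vector, in terms of the trace form. -/
theorem two_mul_weightedNorm_evalAt (hp : (m + 1).Prime) (hζ : IsPrimitiveRoot ζ (m + 1))
    (v : Fin (m + 1) → ℤ) :
    2 * weightedNorm (fun _ => 1) ((evalAt ζ v : 𝓞 F) : F) =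
      ((m + 1 : ℕ) * ∑ i, v i ^ 2 - (∑ i, v i) ^ 2 : ℤ) := by
  have hζF : IsPrimitiveRoot (ζ : F) (m + 1) :=
    hζ.map_of_injective RingOfIntegers.coe_injective
  set η := IsCMField.complexConj F (ζ : F) with hη
  have hζη : (ζ : F) * η = 1 := mul_complexConj_primitiveRoot m.succ_ne_zero hζF.pow_eq_one
  have htr : ∀ i j : Fin (m + 1), Algebra.trace ℚ F ((ζ : F) ^ (i : ℕ) * η ^ (j : ℕ)) =
      (if i = j then ((m + 1 : ℕ) : ℚ) else 0) - 1 := by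
    intro i j
    split_ifs with hij
    · subst hij
      rw [← mul_pow, hζη, one_pow]
      have h1 := Algebra.trace_algebraMap (R := ℚ) (S := F) 1
      rw [map_one, IsCyclotomicExtension.Rat.finrank (m + 1) F, Nat.totient_prime hp] at h1
      rw [h1]
      simp
    · rw [zero_sub]
      apply trace_primitiveRoot hp
      have := Fact.mk hp
      rw [IsPrimitiveRoot.iff_orderOf]
      apply orderOf_eq_prime
      · have hη1 : η ^ (m + 1) = 1 := by rw [hη, ← map_pow, hζF.pow_eq_one, map_one]
        rw [mul_pow, ← pow_mul, ← pow_mul, mul_comm (i : ℕ), mul_comm (j : ℕ), pow_mul, pow_mul,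
          hζF.pow_eq_one, hη1]
        simp
      · intro h
        apply hij
        have h2 : (ζ : F) ^ (i : ℕ) = (ζ : F) ^ (j : ℕ) := by
          have : (ζ : F) ^ (i : ℕ) * (ζ * η) ^ (j : ℕ) = (ζ : F) ^ (j : ℕ) := by
            rw [mul_pow, ← mul_assoc, mul_right_comm, h, one_mul]
          rwa [hζη, one_pow, mul_one] at this
        exact Fin.ext (hζF.pow_inj i.2 j.2 h2)
  have hα : ((evalAt ζ v : 𝓞 F) : F) = ∑ i, (v i : F) * (ζ : F) ^ (i : ℕ) := by
    simp [evalAt]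
  have hconj : IsCMField.complexConj F ((evalAt ζ v : 𝓞 F) : F) = ∑ i, (v i : F) * η ^ (i : ℕ) := by
    simp [evalAt, hη]
  have hsum := two_mul_sum_sigmaMap ((evalAt ζ v : 𝓞 F) : F)
  have htrace : Algebra.trace ℚ F (((evalAt ζ v : 𝓞 F) : F) * IsCMField.complexConj F ((evalAt ζ v : 𝓞 F) : F)) =
      ((m + 1 : ℕ) * ∑ i, v i ^ 2 - (∑ i, v i) ^ 2 : ℤ) := by
    rw [hconj, hα, Finset.sum_mul_sum]
    have hterm : ∀ i j : Fin (m + 1), Algebra.trace ℚ F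
        ((v i : F) * (ζ : F) ^ (i : ℕ) * ((v j : F) * η ^ (j : ℕ))) =
        (if i = j then (v i * v j) * ((m + 1 : ℕ) : ℚ) else 0) - v i * v j := by
      intro i j
      have : (v i : F) * (ζ : F) ^ (i : ℕ) * ((v j : F) * η ^ (j : ℕ)) =
          ((v i * v j : ℤ) : ℚ) • ((ζ : F) ^ (i : ℕ) * η ^ (j : ℕ)) := by
        rw [Algebra.smul_def, map_intCast]; push_cast; ring
      rw [this, map_smul, htr]
      split_ifs <;> push_cast <;> ring
    simp only [map_sum, hterm, Finset.sum_sub_distrib, Finset.sum_ite_eq, Finset.mem_univ, if_true]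
    rw [← Finset.sum_mul_sum, ← Finset.sum_mul]
    push_cast
    simp only [pow_two]
    ring
  rw [htrace] at hsum
  simp only [weightedNorm, one_mul, hsum]
  norm_cast

theorem exists_single_of_sum_sq_eq_one {d : ℕ} {v : Fin d → ℤ} (h : ∑ i, v i ^ 2 = 1) :
    ∃ i, v = Pi.single i 1 ∨ v = -Pi.single i 1 := by
  obtain ⟨i, hi⟩ : ∃ i, v i ≠ 0 := by
    by_contra! h0
    simp [h0] at h
  rw [← Finset.add_sum_erase _ _ (Finset.mem_univ i)] at h
  have h1 : 1 ≤ v i ^ 2 := Int.add_one_le_iff.2 (sq_pos_of_ne_zero hi)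
  have h2 : ∀ j ∈ Finset.univ.erase i, 0 ≤ v j ^ 2 := fun j _ => sq_nonneg _
  have h3 : ∑ j ∈ Finset.univ.erase i, v j ^ 2 = 0 :=
    le_antisymm (by linarith) (Finset.sum_nonneg h2)
  have h4 : ∀ j, j ≠ i → v j = 0 := fun j hj => by
    simpa using (Finset.sum_eq_zero_iff_of_nonneg h2).1 h3 j (by simp [hj])
  have h5 : v i = 1 ∨ v i = -1 := mul_self_eq_one_iff.1 (by linarith [pow_two (v i)])
  refine ⟨i, h5.imp (fun h => ?_) fun h => ?_⟩ <;>
  · ext j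
    by_cases hj : j = i
    · subst hj; simp [h]
    · simp [hj, h4 j hj]

/-- A relation between the powers of `ζ` is a multiple of `(1, …, 1)`, so that a nonzero one has
coordinate sum at least `m + 1` in absolute value. -/
theorem eq_zero_of_evalAt_eq_zero (hp : (m + 1).Prime) (h5 : 5 ≤ m + 1)
    (hζ : IsPrimitiveRoot ζ (m + 1)) {v : Fin (m + 1) → ℤ} (h : evalAt ζ v = 0)
    (hs : (∑ i, v i) ^ 2 ≤ 4) : v = 0 := by
  have h1 := two_mul_weightedNorm_evalAt hp hζ v
  rw [h] at h1
  have h2 : weightedNorm (fun _ => 1) ((0 : 𝓞 F) : F) = 0 := by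
    simp [weightedNorm, sigmaMap]
  rw [h2, mul_zero] at h1
  have h3 : ((m + 1 : ℕ) : ℤ) * ∑ i, v i ^ 2 - (∑ i, v i) ^ 2 = 0 := by exact_mod_cast h1.symm
  have hnn : ∀ j ∈ Finset.univ, 0 ≤ v j ^ 2 := fun j _ => sq_nonneg _
  have h4 : ∑ i, v i ^ 2 = 0 := by
    have h0 := Finset.sum_nonneg hnn
    have h5' : (5 : ℤ) ≤ ((m + 1 : ℕ) : ℤ) := by exact_mod_cast h5
    by_contra hne
    have : 1 ≤ ∑ i, v i ^ 2 := by omega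
    nlinarith
  ext i
  simpa using (Finset.sum_eq_zero_iff_of_nonneg hnn).1 h4 i (Finset.mem_univ i)

omit [IsCMField F] in
theorem exists_evalAt_eq_of_torsion (hodd : Odd (m + 1)) (hζ : IsPrimitiveRoot ζ (m + 1))
    {u : (𝓞 F)ˣ} (hu : u ∈ Units.torsion F) :
    ∃ v : Fin (m + 1) → ℤ, ∑ i, v i ^ 2 = 1 ∧ evalAt ζ v = u := by
  have hζF : IsPrimitiveRoot (ζ : F) (m + 1) :=
    hζ.map_of_injective RingOfIntegers.coe_injective
  have hfin : IsOfFinOrder (u : F) := by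
    rw [Units.torsion, CommGroup.mem_torsion] at hu
    exact (((algebraMap (𝓞 F) F).toMonoidHom.comp (Units.coeHom _)).isOfFinOrder hu)
  obtain ⟨r, hr⟩ := hζF.exists_neg_pow_of_isOfFinOrder hodd hfin
  have hr' : (u : 𝓞 F) = (-ζ) ^ r := by
    apply RingOfIntegers.coe_injective
    rw [hr]; simp
  have hmod : ζ ^ r = ζ ^ (r % (m + 1)) := (pow_mod_orderOf ζ r).symm.trans (by
    rw [← hζ.eq_orderOf])
  let i : Fin (m + 1) := ⟨r % (m + 1), Nat.mod_lt _ m.succ_pos⟩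
  have hi : evalAt ζ (Pi.single i 1 : Fin (m + 1) → ℤ) = ζ ^ r := by
    rw [evalAt_single, hmod]
  have hsq : ∑ j, (Pi.single i 1 : Fin (m + 1) → ℤ) j ^ 2 = 1 := by
    simp [Pi.single_apply]
  rcases neg_one_pow_eq_or (𝓞 F) r with h | h
  · exact ⟨Pi.single i 1, hsq, by rw [hi, hr', neg_pow, h, one_mul]⟩
  · exact ⟨-Pi.single i 1, by simpa using hsq, by
      rw [evalAt_neg, hi, hr', neg_pow, h, neg_one_mul]⟩

/-- The lattice `ℤ^{m+1}` itself is not embedded by evaluation at `ζ`; its shortest vectors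
correspond to the roots of unity. -/
theorem bijOn_evalAt_zero (hp : (m + 1).Prime) (h5 : 5 ≤ m + 1)
    (hζ : IsPrimitiveRoot ζ (m + 1)) :
    Set.BijOn (evalAt ζ) {v | IsShortest (craigLattice m 0) v}
      {α : 𝓞 F | ∃ u : (𝓞 F)ˣ, α = u ∧ ∀ u' : (𝓞 F)ˣ,
        weightedNorm (fun _ => 1) (u : F) ≤ weightedNorm (fun _ => 1) (u' : F)} := by
  have hodd : Odd (m + 1) := hp.odd_of_ne_two (by omega)
  have hset : ∀ v : Fin (m + 1) → ℤ, IsShortest (craigLattice m 0) v ↔ ∑ i, v i ^ 2 = 1 := by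
    have hmem : ∀ v : Fin (m + 1) → ℤ, v ∈ craigLattice m 0 := fun v => ⟨v, by simp⟩
    have hpos : ∀ v : Fin (m + 1) → ℤ, v ≠ 0 → 1 ≤ ∑ i, v i ^ 2 := by
      intro v hv
      obtain ⟨i, hi⟩ := Function.ne_iff.1 hv
      have h1 : 1 ≤ v i ^ 2 := Int.add_one_le_iff.2 (sq_pos_of_ne_zero hi)
      exact h1.trans (Finset.single_le_sum (f := fun i => v i ^ 2) (fun j _ => sq_nonneg _)
        (Finset.mem_univ i))
    intro v
    constructor
    · rintro ⟨-, hv, hmin⟩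
      refine le_antisymm ?_ (hpos v hv)
      simpa [Pi.single_apply] using hmin (Pi.single 0 1) (hmem _) (by simp)
    · intro h
      refine ⟨hmem v, ?_, fun w _ hw => h ▸ hpos w hw⟩
      rintro rfl
      simp at h
  have hcard : ∀ u : (𝓞 F)ˣ,
      (Fintype.card (RealEmb F) : ℝ) ≤ weightedNorm (fun _ => 1) (u : F) := fun u => by
    simpa [weightedNorm] using card_le_sum_of_one_le_prod _ (sigmaMap_unit_pos u)
      (fieldNorm_unit u).ge
  refine ⟨?_, ?_, ?_⟩
  · intro v hv
    obtain ⟨i, hi⟩ := exists_single_of_sum_sq_eq_one ((hset v).1 hv)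
    have hfin : ∃ u : (𝓞 F)ˣ, u ∈ Units.torsion F ∧ evalAt ζ v = u := by
      let z := hζ.isUnit m.succ_ne_zero |>.unit
      have hz : z ∈ Units.torsion F := by
        rw [Units.torsion, CommGroup.mem_torsion, isOfFinOrder_iff_pow_eq_one]
        exact ⟨m + 1, m.succ_pos, by ext1; simpa [z] using hζ.pow_eq_one⟩
      rcases hi with rfl | rfl
      · exact ⟨z ^ (i : ℕ), pow_mem hz _, by simp [evalAt_single, z]⟩
      · refine ⟨-1 * z ^ (i : ℕ), mul_mem ?_ (pow_mem hz _), by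
          simp [evalAt_neg, evalAt_single, z]⟩
        rw [Units.torsion, CommGroup.mem_torsion, isOfFinOrder_iff_pow_eq_one]
        exact ⟨2, two_pos, by simp⟩
    obtain ⟨u, hu, huv⟩ := hfin
    refine ⟨u, huv, fun u' => le_trans (le_of_eq ?_) (hcard u')⟩
    simp [weightedNorm, mem_torsion_iff_sigmaMap.1 hu]
  · intro v hv w hw hvw
    rw [← sub_eq_zero]
    apply eq_zero_of_evalAt_eq_zero hp h5 hζ (by rw [evalAt_sub, hvw, sub_self])
    have hsum : ∀ v : Fin (m + 1) → ℤ, ∑ i, v i ^ 2 = 1 → |∑ i, v i| ≤ 1 := by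
      intro v hv
      obtain ⟨i, rfl | rfl⟩ := exists_single_of_sum_sq_eq_one hv <;> simp
    have h1 := abs_le.1 (hsum v ((hset v).1 hv))
    have h2 := abs_le.1 (hsum w ((hset w).1 hw))
    simp only [Pi.sub_apply, Finset.sum_sub_distrib]
    nlinarith
  · rintro _ ⟨u, rfl, hmin⟩
    have hu : u ∈ Units.torsion F := mem_torsion_of_sum_lt <| by
      have h1 := hmin 1
      simp only [weightedNorm, one_mul, Units.val_one, map_one, sigmaMap_one, Finset.sum_const,
        Finset.card_univ, nsmul_eq_mul, mul_one] at h1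
      linarith
    obtain ⟨v, hv, huv⟩ := exists_evalAt_eq_of_torsion hodd hζ hu
    exact ⟨v, (hset v).2 hv, huv⟩

/-- For `r ≥ 1` the vectors of the Craig lattice have coordinate sum `0`, and evaluation at `ζ` is a
similarity onto the ideal generated by `(1 - ζ)^r`. -/
theorem bijOn_evalAt_isMinimalVector (hp : (m + 1).Prime) (h5 : 5 ≤ m + 1)
    (hζ : IsPrimitiveRoot ζ (m + 1)) {r : ℕ} (hr : r ≠ 0) :
    Set.BijOn (evalAt ζ) {v | IsShortest (craigLattice m r) v}
      {α : 𝓞 F | IsMinimalVector (Ideal.span {(1 - ζ) ^ r}) (fun _ => 1) α} := by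
  have himage := image_craigLattice (F := F) hζ r
  have hmem : ∀ v ∈ craigLattice m r, evalAt ζ v ∈ Ideal.span {(1 - ζ) ^ r} := fun v hv => by
    rw [← SetLike.mem_coe, ← himage]
    exact Set.mem_image_of_mem _ hv
  have hsurj : ∀ α ∈ Ideal.span {(1 - ζ) ^ r}, ∃ v ∈ craigLattice m r, evalAt ζ v = α :=
    fun α hα => by
      rw [← SetLike.mem_coe, ← himage] at hα
      exact hα
  have hzero : ∀ v ∈ craigLattice m r, evalAt ζ v = 0 → v = 0 := fun v hv h =>
    eq_zero_of_evalAt_eq_zero hp h5 hζ h (by rw [sum_eq_zero_of_mem_craigLattice hr hv]; norm_num)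
  have hnorm : ∀ v ∈ craigLattice m r, ∀ w ∈ craigLattice m r,
      (weightedNorm (fun _ => 1) ((evalAt ζ v : 𝓞 F) : F) ≤
        weightedNorm (fun _ => 1) ((evalAt ζ w : 𝓞 F) : F) ↔ ∑ i, v i ^ 2 ≤ ∑ i, w i ^ 2) := by
    intro v hv w hw
    have h1 := two_mul_weightedNorm_evalAt (F := F) hp hζ v
    have h2 := two_mul_weightedNorm_evalAt (F := F) hp hζ w
    rw [sum_eq_zero_of_mem_craigLattice hr hv] at h1
    rw [sum_eq_zero_of_mem_craigLattice hr hw] at h2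
    rw [← mul_le_mul_iff_right₀ (two_pos : (0 : ℝ) < 2), h1, h2, Int.cast_le]
    have : (0 : ℤ) < ((m + 1 : ℕ) : ℤ) := by positivity
    simp only [ne_eq, OfNat.ofNat_ne_zero, not_false_eq_true, zero_pow, sub_zero]
    exact mul_le_mul_iff_right₀ this
  have hev0 : evalAt ζ (0 : Fin (m + 1) → ℤ) = 0 := map_zero (evalAddHom ζ (m + 1))
  refine ⟨?_, ?_, ?_⟩
  · rintro v ⟨hv, h0, hmin⟩
    refine ⟨hmem v hv, fun h => h0 (hzero v hv h), fun β hβ hβ0 => ?_⟩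
    obtain ⟨w, hw, rfl⟩ := hsurj β hβ
    exact (hnorm v hv w hw).2 (hmin w hw fun h => hβ0 (by rw [h, hev0]))
  · rintro v ⟨hv, -, -⟩ w ⟨hw, -, -⟩ hvw
    rw [← sub_eq_zero]
    exact hzero _ (sub_mem hv hw) (by rw [evalAt_sub, hvw, sub_self])
  · rintro α ⟨hα, h0, hmin⟩
    obtain ⟨v, hv, rfl⟩ := hsurj α hα
    refine ⟨v, ⟨hv, fun h => h0 (by rw [h, hev0]), fun w hw hw0 => ?_⟩, rfl⟩
    exact (hnorm v hv w hw).1 (hmin _ (hmem w hw) fun h => hw0 (hzero w hw h))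

end Cyclotomic

/-! ### Real cyclotomic coordinates, free generators and simplex bounds -/

open Polynomial in
/-- `t σ = 2 cos (2πj/n)`, the image of `ζ + ζ⁻¹` under `σ`. These numbers separate the real
embeddings. -/
theorem exists_realCoord {F : Type*} [Field F] [NumberField F] [IsCMField F] {n : ℕ} [NeZero n]
    [IsCyclotomicExtension {n} ℚ F] {ζ : 𝓞 F} (hζ : IsPrimitiveRoot ζ n) :
    ∃ t : RealEmb F → ℝ, Function.Injective t ∧ ∀ (σ : RealEmb F) (P : ℤ[X]),
      sigmaMap ((aeval (ζ + ζ ^ (n - 1)) P : 𝓞 F) : F) σ = (aeval (t σ) P) ^ 2 := by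
  have hζF : IsPrimitiveRoot (ζ : F) n := hζ.map_of_injective RingOfIntegers.coe_injective
  choose φ hφ using exists_extension_realEmb (F := F)
  have hnorm : ∀ σ, ‖φ σ ζ‖ = 1 := fun σ =>
    Complex.norm_eq_one_of_pow_eq_one (by rw [← map_pow, hζF.pow_eq_one, map_one])
      (NeZero.ne n)
  have hconj : ∀ σ, φ σ (ζ : F) ^ (n - 1) = (starRingEnd ℂ) (φ σ ζ) := by
    intro σ
    have h1 : φ σ (ζ : F) * φ σ (ζ : F) ^ (n - 1) = 1 := by
      rw [← pow_succ', Nat.sub_add_cancel (NeZero.pos n), ← map_pow, hζF.pow_eq_one, map_one]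
    have h2 : φ σ (ζ : F) * (starRingEnd ℂ) (φ σ ζ) = 1 := by
      rw [Complex.mul_conj, Complex.normSq_eq_norm_sq, hnorm]; simp
    exact mul_left_cancel₀ (left_ne_zero_of_mul_eq_one h1) (h1.trans h2.symm)
  refine ⟨fun σ => 2 * (φ σ ζ).re, fun σ τ h => ?_, fun σ P => ?_⟩
  · have hre : (φ σ ζ).re = (φ τ ζ).re := by simpa using h
    have him : (φ σ ζ).im ^ 2 = (φ τ ζ).im ^ 2 := by
      have h1 := Complex.sq_norm (φ σ ζ)
      have h2 := Complex.sq_norm (φ τ ζ)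
      rw [hnorm, Complex.normSq_apply] at h1 h2
      rw [hre] at h1
      linarith
    -- two ring homomorphisms agreeing on `ζ` agree
    have hext : ∀ ψ : F →+* ℂ, φ σ ζ = ψ ζ → φ σ = ψ := by
      intro ψ h
      have : (φ σ).toRatAlgHom = ψ.toRatAlgHom :=
        (hζF.powerBasis ℚ).algHom_ext (by simpa using h)
      ext x
      exact DFunLike.congr_fun this x
    ext x
    rw [← Complex.ofReal_inj, ← hφ σ, ← hφ τ]
    rcases sq_eq_sq_iff_eq_or_eq_neg.1 him with him | him
    · rw [hext (φ τ) (Complex.ext hre him)]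
    · rw [hext ((starRingEnd ℂ).comp (φ τ)) (Complex.ext (by simpa using hre) (by simpa using him))]
      simp [hφ τ x]
  · rw [sigmaMap_eq_norm_sq (hφ σ)]
    have h1 : φ σ ((ζ + ζ ^ (n - 1) : 𝓞 F) : F) = ((2 * (φ σ ζ).re : ℝ) : ℂ) := by
      simp only [map_add, map_pow, hconj, Complex.add_conj]
    have h2 : φ σ ((aeval (ζ + ζ ^ (n - 1)) P : 𝓞 F) : F) =
        ((aeval (2 * (φ σ ζ).re) P : ℝ) : ℂ) := by
      rw [← Complex.coe_algebraMap, ← aeval_algebraMap_apply, Complex.coe_algebraMap, ← h1]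
      rw [aeval_def, aeval_def, ← RingHom.comp_apply, hom_eval₂]
      congr 1
      exact RingHom.ext_int _ _
    rw [h2, Complex.norm_real, Real.norm_eq_abs, sq_abs]

section Units

variable {F : Type*} [Field F] [NumberField F] [IsCMField F]

theorem IsReducing.isFundamentalSystem {m : ℕ} {g : Fin m → (𝓞 F)ˣ}
    (hg : IsReducing (Subgroup.closure (Set.range g)))
    (hind : ∀ a : Fin m → ℤ, (∀ σ : RealEmb F, ∏ i, sigmaMap (g i : F) σ ^ a i = 1) → a = 0) :
    IsFundamentalSystem g := by
  have hind' : ∀ a : Fin m → ℤ, ∏ i, g i ^ a i ∈ Units.torsion F → a = 0 := by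
    intro a ha
    refine hind a fun σ => ?_
    rw [← mem_torsion_iff_sigmaMap.1 ha σ]
    change _ = sigmaHom σ (∏ i, g i ^ a i)
    rw [map_prod]
    exact Finset.prod_congr rfl fun i _ => (sigmaMap_units_zpow (g i) (a i) σ).symm
  intro y
  obtain ⟨t, ht, u, hu, rfl⟩ := hg.exists_eq_torsion_mul y
  obtain ⟨a, rfl⟩ := Subgroup.mem_closure_range_iff_of_fintype.1 hu
  refine ⟨(⟨t, ht⟩, a), rfl, ?_⟩
  rintro ⟨⟨t', ht'⟩, a'⟩ h
  simp only at h
  have hsub : ∏ i, g i ^ (a - a') i = t⁻¹ * t' := by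
    simp only [Pi.sub_apply, zpow_sub, Finset.prod_mul_distrib, Finset.prod_inv_distrib]
    rw [mul_inv_eq_iff_eq_mul, mul_assoc, ← h, inv_mul_cancel_left]
  have ha : a' = a := (sub_eq_zero.1 (hind' (a - a') (hsub ▸ mul_mem (inv_mem ht) ht'))).symm
  subst ha
  have : t' = t := (mul_right_cancel h).symm
  subst this
  rfl

end Units

theorem simplexBound_two (A : Matrix (Fin 2) (Fin 2) ℝ) :
    simplexBound A = |((A 0 0 * A 1 1 - A 0 1 * A 1 0) / 2) ^ 2 /
      ((A 1 1 - A 0 1) * (A 1 0 - A 0 0))| := by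
  simp [simplexBound, diffMatrix, Matrix.det_fin_two, Fin.prod_univ_two, div_eq_mul_inv]

theorem simplexBound_three (A : Matrix (Fin 3) (Fin 3) ℝ) (h : ∀ j, A 0 j = 1) :
    simplexBound A = |((A 1 1 * A 2 2 - A 1 2 * A 2 1 - (A 1 0 * A 2 2 - A 1 2 * A 2 0)
        + (A 1 0 * A 2 1 - A 1 1 * A 2 0)) / 3) ^ 3 /
      (((A 1 1 - 1) * (A 2 2 - A 1 2) - (A 1 2 - 1) * (A 2 1 - A 1 1)) *
        ((A 1 0 - 1) * (A 2 2 - A 1 2) - (A 1 2 - 1) * (A 2 0 - A 1 0)) *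
        ((A 1 0 - 1) * (A 2 1 - A 1 1) - (A 1 1 - 1) * (A 2 0 - A 1 0)))| := by
  have hs : (Fin.succAbove (1 : Fin 3) 1 : Fin 3) = 2 := rfl
  have hs' : (Fin.succAbove (2 : Fin 3) 1 : Fin 3) = 1 := rfl
  have hs0 : (Fin.succAbove (2 : Fin 3) 0 : Fin 3) = 0 := rfl
  have hd := Matrix.det_fin_three A
  simp only [h, one_mul] at hd
  have hd' : A.det = A 1 1 * A 2 2 - A 1 2 * A 2 1 - (A 1 0 * A 2 2 - A 1 2 * A 2 0)
        + (A 1 0 * A 2 1 - A 1 1 * A 2 0) := by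
    rw [hd]; ring
  have hB := fun l : Fin 3 =>
    Matrix.det_fin_two ((diffMatrix A).submatrix id (Fin.succAbove l))
  simp only [diffMatrix, Matrix.submatrix_apply, Matrix.of_apply, id, Fin.succ_zero_eq_one,
    Fin.succ_one_eq_two, Fin.castSucc_zero, Fin.castSucc_one, h] at hB
  rw [simplexBound, Fin.prod_univ_three]
  simp only [diffMatrix]
  rw [hB, hB, hB, hd', div_eq_mul_inv _ (_ * _ * _), mul_inv, mul_inv]
  simp only [Fin.succAbove_zero, Fin.succ_zero_eq_one, Fin.succ_one_eq_two,
    Fin.one_succAbove_zero, hs, hs', hs0]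
  norm_num

/-! ### The fifth cyclotomic field -/

section Five

variable {F : Type*} [Field F] [NumberField F] [IsCMField F] [IsCyclotomicExtension {5} ℚ F]

theorem card_realEmb_five : Fintype.card (RealEmb F) = 2 := by
  have h := finrank_eq_two_mul_card (F := F)
  rw [IsCyclotomicExtension.Rat.finrank 5 F, Nat.totient_prime Nat.prime_five] at h
  omega

open Polynomial in
/-- The unit `ζ + ζ⁻¹`, whose conjugates are `(-1 ± √5) / 2`. -/
theorem exists_unit_five {ζ : 𝓞 F} (hζ : IsPrimitiveRoot ζ 5) :
    ∃ (ε : (𝓞 F)ˣ) (t : RealEmb F → ℝ), Function.Injective t ∧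
      (∀ σ, t σ ^ 2 + t σ - 1 = 0) ∧ ∀ σ, sigmaMap (ε : F) σ = t σ ^ 2 := by
  obtain ⟨t, ht, hP⟩ := exists_realCoord hζ
  have hgeom := hζ.geom_sum_eq_zero (by norm_num)
  simp only [Finset.sum_range_succ, Finset.sum_range_zero] at hgeom
  have hrel : (ζ + ζ ^ (5 - 1)) ^ 2 + (ζ + ζ ^ (5 - 1)) - 1 = 0 := by
    norm_num
    linear_combination hgeom + (2 + ζ ^ 3) * hζ.pow_eq_one
  refine ⟨Units.mkOfMulEqOne (ζ + ζ ^ (5 - 1)) (ζ + ζ ^ (5 - 1) + 1)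
    (by linear_combination hrel), t, ht, fun σ => ?_, fun σ => ?_⟩
  · have h := hP σ (X ^ 2 + X - 1)
    simp only [map_sub, map_add, map_pow, aeval_X, map_one] at h
    rw [← sq_eq_zero_iff, ← h]
    have h0 : sigmaMap (((ζ + ζ ^ (5 - 1)) ^ 2 + (ζ + ζ ^ (5 - 1)) - 1 : 𝓞 F) : F) σ = 0 := by
      rw [hrel]; simp [sigmaMap]
    simpa using h0
  · have h := hP σ X
    rw [aeval_X, aeval_X] at h
    exact h

omit [NumberField F] [IsCMField F] [IsCyclotomicExtension {5} ℚ F] in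
theorem eq_neg_one_sub_five {t : RealEmb F → ℝ} (ht : Function.Injective t)
    (hroot : ∀ σ, t σ ^ 2 + t σ - 1 = 0) (e : Fin 2 ≃ RealEmb F) : t (e 1) = -1 - t (e 0) := by
  have hne : t (e 0) - t (e 1) ≠ 0 :=
    sub_ne_zero.2 fun h => by simpa using e.injective (ht h)
  apply mul_left_cancel₀ hne
  linear_combination hroot (e 0) - hroot (e 1)

theorem isReducing_five {t : RealEmb F → ℝ} (ht : Function.Injective t)
    (hroot : ∀ σ, t σ ^ 2 + t σ - 1 = 0) {ε : (𝓞 F)ˣ} (hε : ∀ σ, sigmaMap (ε : F) σ = t σ ^ 2)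
    {H : Subgroup (𝓞 F)ˣ} (hH : ε ∈ H) : IsReducing H := by
  refine isReducing_of_reduced fun y hy hred => ?_
  have e : Fin 2 ≃ RealEmb F := (Fintype.equivFinOfCardEq card_realEmb_five).symm
  have h0 := hroot (e 0)
  have h1 := eq_neg_one_sub_five ht hroot e
  have ha := hred ε hH
  have hb := hred ε⁻¹ (H.inv_mem hH)
  simp only [sigmaMap_units_inv, hε] at ha hb
  rw [← e.sum_comp, ← e.sum_comp, Fin.sum_univ_two, Fin.sum_univ_two, h1] at ha hb
  rw [card_realEmb_five, ← e.sum_comp, ← e.prod_comp, Fin.sum_univ_two, Fin.prod_univ_two]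
  have hpa := hy (e 0)
  have hpb := hy (e 1)
  set a := y (e 0)
  set b := y (e 1)
  set s := t (e 0)
  have hs2 : s ^ 2 = 1 - s := by linarith
  have hs2' : (-1 - s) ^ 2 = 2 + s := by linear_combination h0
  have hsi : (s ^ 2)⁻¹ = 2 + s := by
    rw [hs2]
    exact inv_eq_of_mul_eq_one_right (by linear_combination -h0)
  have hsi' : ((-1 - s) ^ 2)⁻¹ = 1 - s := by
    rw [hs2']
    exact inv_eq_of_mul_eq_one_left (by linear_combination -h0)
  rw [hs2, hs2'] at ha
  rw [hsi, hsi'] at hb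
  -- the product of the two comparisons is `a ^ 2 + b ^ 2 ≤ 3 a b`
  have h3 : 0 ≤ (b * (1 + s) - a * s) * (a * (1 + s) - b * s) :=
    mul_nonneg (by linarith) (by linarith)
  have h4 : (b * (1 + s) - a * s) * (a * (1 + s) - b * s) = 3 * (a * b) - a ^ 2 - b ^ 2 := by
    linear_combination (2 * a * b - a ^ 2 - b ^ 2) * h0
  have := mul_pos hpa hpb
  norm_num
  nlinarith

theorem isFundamentalSystem_five {t : RealEmb F → ℝ} (ht : Function.Injective t)
    (hroot : ∀ σ, t σ ^ 2 + t σ - 1 = 0) {ε : (𝓞 F)ˣ} (hε : ∀ σ, sigmaMap (ε : F) σ = t σ ^ 2) :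
    IsFundamentalSystem (fun _ : Fin 1 => ε) := by
  refine IsReducing.isFundamentalSystem (isReducing_five ht hroot hε
    (Subgroup.subset_closure ⟨0, rfl⟩)) fun a ha => ?_
  let σ : RealEmb F := Classical.choice inferInstance
  have h := ha σ
  have hpos := sigmaMap_unit_pos ε σ
  have hr := hroot σ
  simp only [Fin.prod_univ_one] at h
  have hne : sigmaMap (ε : F) σ ≠ 1 := by
    rw [hε]
    intro h1
    have h2 : t σ = 0 := by linarith
    rw [h2] at h1
    norm_num at h1
  ext i
  rw [Subsingleton.elim i 0]
  exact (zpow_eq_one_iff_right₀ hpos.le hne).1 h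

/-- A free generator equals `ε^{±1}` up to torsion, and both signs give the same value. -/
theorem boundValues_five {t : RealEmb F → ℝ} (ht : Function.Injective t)
    (hroot : ∀ σ, t σ ^ 2 + t σ - 1 = 0) {ε : (𝓞 F)ˣ} (hε : ∀ σ, sigmaMap (ε : F) σ = t σ ^ 2)
    {g : Fin 1 → (𝓞 F)ˣ} (hg : IsFundamentalSystem g) (e : Fin 2 ≃ RealEmb F) :
    boundValues e g = {5 / 4} := by
  have hpow : ∀ (g h : Fin 1 → (𝓞 F)ˣ), IsFundamentalSystem g →
      ∃ a : ℤ, ∀ σ, sigmaMap (h 0 : F) σ = sigmaMap (g 0 : F) σ ^ a := by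
    intro g h hg
    obtain ⟨⟨t, a⟩, hta, -⟩ := hg (h 0)
    refine ⟨a 0, fun σ => ?_⟩
    simp only [Fin.prod_univ_one] at hta
    rw [hta, sigmaMap_units_mul, mem_torsion_iff_sigmaMap.1 t.2, sigmaMap_units_zpow, one_mul]
  obtain ⟨a, ha⟩ := hpow g (fun _ => ε) hg
  obtain ⟨b, hb⟩ := hpow (fun _ => ε) g (isFundamentalSystem_five ht hroot hε)
  have h0 := hroot (e 0)
  have h1 := eq_neg_one_sub_five ht hroot e
  set s := t (e 0) with hs
  have hs0 : sigmaMap (ε : F) (e 0) = 1 - s := by rw [hε]; linear_combination h0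
  have hs1 : sigmaMap (ε : F) (e 1) = 2 + s := by rw [hε, h1]; linear_combination h0
  have hmul : (1 - s) * (2 + s) = 1 := by linear_combination -h0
  have hab : b * a - 1 = 0 := by
    have hpos := sigmaMap_unit_pos ε (e 0)
    refine (zpow_eq_one_iff_right₀ hpos.le ?_).1 (?_ : sigmaMap (ε : F) (e 0) ^ (b * a - 1) = 1)
    · rw [hs0]
      intro h
      have : s = 0 := by linarith
      rw [this] at h0
      norm_num at h0
    · rw [zpow_sub_one₀ hpos.ne', zpow_mul, ← hb, ← ha, mul_inv_cancel₀ hpos.ne']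
  have hb1 : b = 1 ∨ b = -1 := Int.isUnit_iff.1 (IsUnit.of_mul_eq_one a (by linarith))
  have key : ∀ σ : Equiv.Perm (Fin 1), simplexBound (vertexMatrix e g σ) = 5 / 4 := by
    intro σ
    have hv0 : ∀ j, vertexMatrix e g σ 0 j = 1 := by
      intro j; simp [vertexMatrix, chainPoint]
    have hv1 : ∀ j, vertexMatrix e g σ 1 j = sigmaMap (g 0 : F) (e j) := by
      intro j; simp [vertexMatrix, chainPoint, Subsingleton.elim (σ 0) 0]
    rw [simplexBound_two, hv0, hv0, hv1, hv1]
    have h5 : ∀ p q : ℝ, (q - p) ^ 2 = 5 → (q - 1) * (p - 1) = -1 →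
        |((1 * q - 1 * p) / 2) ^ 2 / ((q - 1) * (p - 1))| = 5 / 4 := by
      intro p q h1 h2
      rw [h2, one_mul, one_mul, div_pow, h1]
      norm_num [abs_of_neg]
    have hi0 : (1 - s)⁻¹ = 2 + s := inv_eq_of_mul_eq_one_right hmul
    have hi1 : (2 + s)⁻¹ = 1 - s := inv_eq_of_mul_eq_one_left hmul
    rcases hb1 with rfl | rfl
    · simp only [zpow_one] at hb
      rw [hb, hb, hs0, hs1]
      exact h5 _ _ (by linear_combination 4 * h0) (by linear_combination -h0)
    · simp only [zpow_neg, zpow_one] at hb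
      rw [hb, hb, hs0, hs1, hi0, hi1]
      exact h5 _ _ (by linear_combination 4 * h0) (by linear_combination -h0)
  rw [boundValues]
  simp only [key, Set.range_const]

end Five

/-! ### The seventh cyclotomic field -/

/-- The cone of reduced weights for `n = 7`, with coefficients rounded outwards. On it the cubic form
`64 abc - (a + b + c)³` is a nonnegative combination of products of three of the defining linear
forms and of `abc`. -/
theorem add_pow_three_lt_of_reduced {a b c : ℝ} (ha : 0 < a) (hb : 0 < b) (hc : 0 < c)
    (h1 : 0 ≤ 0.555 * a - 0.801 * b + 2.247 * c) (h2 : 0 ≤ 0.555 * c - 0.801 * a + 2.247 * b)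
    (h3 : 0 ≤ 0.555 * b - 0.801 * c + 2.247 * a) (k1 : 0 ≤ -0.356 * a + 4.049 * b - 0.692 * c)
    (k2 : 0 ≤ -0.356 * b + 4.049 * c - 0.692 * a) (k3 : 0 ≤ -0.356 * c + 4.049 * a - 0.692 * b) :
    (a + b + c) ^ 3 < 64 * (a * b * c) := by
  have : 0 < a * b * c := by positivity
  linarith [mul_nonneg (mul_nonneg k1 k2) k3,
    mul_nonneg (mul_nonneg h1 k2) k3,
    mul_nonneg (mul_nonneg h2 k1) k3,
    mul_nonneg (mul_nonneg h3 k1) k2,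
    mul_nonneg (mul_nonneg h1 h2) k1,
    mul_nonneg (mul_nonneg h2 h3) k2,
    mul_nonneg (mul_nonneg h1 h3) k3,
    mul_nonneg (mul_nonneg h1 h1) k1,
    mul_nonneg (mul_nonneg h2 h2) k2,
    mul_nonneg (mul_nonneg h3 h3) k3,
    mul_nonneg (mul_nonneg h1 h2) k2,
    mul_nonneg (mul_nonneg h2 h3) k3,
    mul_nonneg (mul_nonneg h1 h3) k1,
    mul_nonneg (mul_nonneg h1 h1) h3,
    mul_nonneg (mul_nonneg h1 h2) h2,
    mul_nonneg (mul_nonneg h2 h3) h3]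

/-- The three roots of `x³ + x² - 2x - 1` lie in these disjoint intervals. -/
def rootInterval : Fin 3 → Set ℝ :=
  ![Set.Icc 1.24697 1.24699, Set.Icc (-0.44505) (-0.44504), Set.Icc (-1.80194) (-1.80193)]

theorem exists_mem_rootInterval {x : ℝ} (h : x ^ 3 + x ^ 2 - 2 * x - 1 = 0) :
    ∃ j, x ∈ rootInterval j := by
  by_cases h1 : 1.24699 < x
  · nlinarith [mul_pos (sub_pos.2 h1) (sub_pos.2 h1), mul_pos (mul_pos (sub_pos.2 h1)
      (sub_pos.2 h1)) (sub_pos.2 h1)]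
  by_cases h2 : 1.24697 ≤ x
  · exact ⟨0, h2, not_lt.1 h1⟩
  by_cases h3 : -0.44504 < x
  · push Not at h2
    nlinarith [mul_pos (sub_pos.2 h3) (sub_pos.2 h2), mul_pos (mul_pos (sub_pos.2 h3)
      (sub_pos.2 h2)) (sub_pos.2 h3)]
  by_cases h4 : -0.44505 ≤ x
  · exact ⟨1, h4, not_lt.1 h3⟩
  by_cases h5 : -1.80193 < x
  · push Not at h4
    nlinarith [mul_pos (sub_pos.2 h5) (sub_pos.2 h4), mul_pos (mul_pos (sub_pos.2 h5)
      (sub_pos.2 h4)) (sub_pos.2 h4)]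
  by_cases h6 : -1.80194 ≤ x
  · exact ⟨2, h6, not_lt.1 h5⟩
  · push Not at h6
    nlinarith [mul_pos (sub_pos.2 h6) (sub_pos.2 h6), mul_pos (mul_pos (sub_pos.2 h6)
      (sub_pos.2 h6)) (sub_pos.2 h6)]

theorem eq_of_mem_rootInterval {x y : ℝ} (hx : x ^ 3 + x ^ 2 - 2 * x - 1 = 0)
    (hy : y ^ 3 + y ^ 2 - 2 * y - 1 = 0) {j : Fin 3} (hxj : x ∈ rootInterval j)
    (hyj : y ∈ rootInterval j) : x = y := by
  have h : (x - y) * (x ^ 2 + x * y + y ^ 2 + x + y - 2) = 0 := by linear_combination hx - hy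
  rcases mul_eq_zero.1 h with h | h
  · exact sub_eq_zero.1 h
  · exfalso
    fin_cases j <;> obtain ⟨h1, h2⟩ := hxj <;> obtain ⟨h3, h4⟩ := hyj <;> nlinarith

/-- The other two roots of the cubic polynomial of `2 cos (2π/7)` in terms of one of them. -/
theorem eq_or_eq_of_root {x y : ℝ} (hx : x ^ 3 + x ^ 2 - 2 * x - 1 = 0)
    (hy : y ^ 3 + y ^ 2 - 2 * y - 1 = 0) (hne : x ≠ y) :
    y = x ^ 2 - 2 ∨ y = 1 - x - x ^ 2 := by
  have h : y ^ 2 + x * y + x ^ 2 + y + x - 2 = 0 := by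
    apply mul_left_cancel₀ (sub_ne_zero.2 hne)
    linear_combination hx - hy
  have h2 : (y - (x ^ 2 - 2)) * (y - (1 - x - x ^ 2)) = 0 := by
    linear_combination h - x * hx
  exact (mul_eq_zero.1 h2).imp sub_eq_zero.1 sub_eq_zero.1

section Seven

variable {F : Type*} [Field F] [NumberField F] [IsCMField F] [IsCyclotomicExtension {7} ℚ F]

theorem card_realEmb_seven : Fintype.card (RealEmb F) = 3 := by
  have h := finrank_eq_two_mul_card (F := F)
  rw [IsCyclotomicExtension.Rat.finrank 7 F, Nat.totient_prime Nat.prime_seven] at h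
  omega

open Polynomial in
/-- The units `ζ + ζ⁻¹` and `ζ² + ζ⁻²`. -/
theorem exists_units_seven {ζ : 𝓞 F} (hζ : IsPrimitiveRoot ζ 7) :
    ∃ (g : Fin 2 → (𝓞 F)ˣ) (t : RealEmb F → ℝ), Function.Injective t ∧
      (∀ σ, t σ ^ 3 + t σ ^ 2 - 2 * t σ - 1 = 0) ∧ (∀ σ, sigmaMap (g 0 : F) σ = t σ ^ 2) ∧
      ∀ σ, sigmaMap (g 1 : F) σ = (t σ ^ 2 - 2) ^ 2 := by
  obtain ⟨t, ht, hP⟩ := exists_realCoord hζ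
  have hgeom := hζ.geom_sum_eq_zero (by norm_num)
  simp only [Finset.sum_range_succ, Finset.sum_range_zero] at hgeom
  set τ := ζ + ζ ^ (7 - 1) with hτ
  have hrel : τ ^ 3 + τ ^ 2 - 2 * τ - 1 = 0 := by
    rw [hτ]
    norm_num
    linear_combination hgeom + (3 * ζ + 3 * ζ ^ 6 + ζ ^ 4 * (ζ ^ 7 + 1) + 2 + ζ ^ 5) *
      hζ.pow_eq_one
  refine ⟨![Units.mkOfMulEqOne τ (τ ^ 2 + τ - 2) (by linear_combination hrel),
    Units.mkOfMulEqOne (τ ^ 2 - 2) (-(τ + 1)) (by linear_combination -hrel)], t, ht, fun σ => ?_, fun σ => ?_,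
    fun σ => ?_⟩
  · have h := hP σ (X ^ 3 + X ^ 2 - 2 * X - 1)
    simp only [map_sub, map_add, map_pow, map_mul, aeval_X, map_one, map_ofNat] at h
    rw [← sq_eq_zero_iff, ← h]
    have h0 : sigmaMap ((τ ^ 3 + τ ^ 2 - 2 * τ - 1 : 𝓞 F) : F) σ = 0 := by
      rw [hrel]; simp [sigmaMap]
    exact h0
  · have h := hP σ X
    rw [aeval_X, aeval_X] at h
    exact h
  · have h := hP σ (X ^ 2 - 2)
    rw [map_sub, map_sub, map_pow, map_pow, aeval_X, aeval_X, map_ofNat, map_ofNat] at h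
    exact h

/-- The real embeddings, in decreasing order of their coordinates. -/
theorem exists_equiv_seven {t : RealEmb F → ℝ} (ht : Function.Injective t)
    (hroot : ∀ σ, t σ ^ 3 + t σ ^ 2 - 2 * t σ - 1 = 0) :
    ∃ e : Fin 3 ≃ RealEmb F, ∀ j, t (e j) ∈ rootInterval j := by
  choose f hf using fun σ => exists_mem_rootInterval (hroot σ)
  have hinj : Function.Injective f := fun σ τ h =>
    ht (eq_of_mem_rootInterval (hroot σ) (hroot τ) (hf σ) (h ▸ hf τ))
  have hbij : Function.Bijective f :=
    (Fintype.bijective_iff_injective_and_card f).2 ⟨hinj, by simp [card_realEmb_seven]⟩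
  refine ⟨(Equiv.ofBijective f hbij).symm, fun j => ?_⟩
  have := hf ((Equiv.ofBijective f hbij).symm j)
  rwa [← Equiv.ofBijective_apply f hbij, Equiv.apply_symm_apply] at this

end Seven

theorem sq_bounds_rootInterval_zero {x : ℝ} (h : x ∈ rootInterval 0) :
    1.5549 ≤ x ^ 2 ∧ x ^ 2 ≤ 1.555 := by
  obtain ⟨h1, h2⟩ := h
  constructor <;> nlinarith

theorem sq_bounds_rootInterval_one {x : ℝ} (h : x ∈ rootInterval 1) :
    0.19806 ≤ x ^ 2 ∧ x ^ 2 ≤ 0.199 := by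
  obtain ⟨h1, h2⟩ := h
  constructor <;> nlinarith

theorem sq_bounds_rootInterval_two {x : ℝ} (h : x ∈ rootInterval 2) :
    3.2469 ≤ x ^ 2 ∧ x ^ 2 ≤ 3.247 := by
  obtain ⟨h1, h2⟩ := h
  constructor <;> nlinarith

section Seven

variable {F : Type*} [Field F] [NumberField F] [IsCMField F] [IsCyclotomicExtension {7} ℚ F]

omit [NumberField F] [IsCMField F] [IsCyclotomicExtension {7} ℚ F] in
/-- Doubling the angle, `x ↦ x² - 2`, permutes the numbers `2 cos (2πj/7)` cyclically in the order
given by `rootInterval`. -/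
theorem root_relations_seven {t : RealEmb F → ℝ} (ht : Function.Injective t)
    (hroot : ∀ σ, t σ ^ 3 + t σ ^ 2 - 2 * t σ - 1 = 0) {e : Fin 3 ≃ RealEmb F}
    (he : ∀ j, t (e j) ∈ rootInterval j) :
    t (e 1) = t (e 0) ^ 2 - 2 ∧ t (e 2) = t (e 1) ^ 2 - 2 ∧ t (e 0) = t (e 2) ^ 2 - 2 := by
  have hne : ∀ i j, i ≠ j → t (e i) ≠ t (e j) := fun i j hij h => hij (e.injective (ht h))
  obtain ⟨h0, h0'⟩ := he 0
  obtain ⟨h1, h1'⟩ := he 1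
  obtain ⟨h2, h2'⟩ := he 2
  refine ⟨(eq_or_eq_of_root (hroot _) (hroot _) (hne 0 1 (by decide))).resolve_right ?_,
    (eq_or_eq_of_root (hroot _) (hroot _) (hne 1 2 (by decide))).resolve_right ?_,
    (eq_or_eq_of_root (hroot _) (hroot _) (hne 2 0 (by decide))).resolve_right ?_⟩ <;>
  · intro h
    nlinarith

theorem isReducing_seven {t : RealEmb F → ℝ} (ht : Function.Injective t)
    (hroot : ∀ σ, t σ ^ 3 + t σ ^ 2 - 2 * t σ - 1 = 0) {g : Fin 2 → (𝓞 F)ˣ}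
    (hg0 : ∀ σ, sigmaMap (g 0 : F) σ = t σ ^ 2)
    (hg1 : ∀ σ, sigmaMap (g 1 : F) σ = (t σ ^ 2 - 2) ^ 2) :
    IsReducing (Subgroup.closure (Set.range g)) := by
  set H := Subgroup.closure (Set.range g)
  have hmem : ∀ i, g i ∈ H := fun i => Subgroup.subset_closure ⟨i, rfl⟩
  refine isReducing_of_reduced fun y hy hred => ?_
  obtain ⟨e, he⟩ := exists_equiv_seven ht hroot
  obtain ⟨hr0, hr1, hr2⟩ := root_relations_seven ht hroot he
  have hprod : t (e 0) * t (e 1) * t (e 2) = 1 := by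
    have := hroot (e 0)
    rw [hr1, hr0]
    linear_combination (1 + 2 * t (e 0) - 3 * t (e 0) ^ 2 - t (e 0) ^ 3 + t (e 0) ^ 4) * this
  have ha := hred (g 0) (hmem 0)
  have ha' := hred (g 0)⁻¹ (H.inv_mem (hmem 0))
  have hb := hred (g 1) (hmem 1)
  have hb' := hred (g 1)⁻¹ (H.inv_mem (hmem 1))
  have hc := hred (g 0 * g 1) (H.mul_mem (hmem 0) (hmem 1))
  have hc' := hred (g 0 * g 1)⁻¹ (H.inv_mem (H.mul_mem (hmem 0) (hmem 1)))
  simp only [sigmaMap_units_inv, sigmaMap_units_mul, hg0, hg1] at ha ha' hb hb' hc hc'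
  simp only [← e.sum_comp, Fin.sum_univ_three, ← hr0, ← hr1, ← hr2] at ha ha' hb hb' hc hc'
  rw [card_realEmb_seven, ← e.sum_comp, ← e.prod_comp, Fin.sum_univ_three, Fin.prod_univ_three]
  obtain ⟨hp', hp⟩ := sq_bounds_rootInterval_zero (he 0)
  obtain ⟨hq', hq⟩ := sq_bounds_rootInterval_one (he 1)
  obtain ⟨hr', hr⟩ := sq_bounds_rootInterval_two (he 2)
  have hpa := hy (e 0)
  have hpb := hy (e 1)
  have hpc := hy (e 2)
  set a := y (e 0)
  set b := y (e 1)
  set c := y (e 2)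
  set p := t (e 0)
  set q := t (e 1)
  set r := t (e 2)
  have hip : (p ^ 2)⁻¹ ≤ 0.644 := by
    rw [inv_le_iff_one_le_mul₀ (by linarith)]; linarith
  have hiq : (q ^ 2)⁻¹ ≤ 5.049 := by
    rw [inv_le_iff_one_le_mul₀ (by linarith)]; linarith
  have hir : (r ^ 2)⁻¹ ≤ 0.308 := by
    rw [inv_le_iff_one_le_mul₀ (by linarith)]; linarith
  have e1 : p ^ 2 * q ^ 2 = (r ^ 2)⁻¹ :=
    eq_inv_of_mul_eq_one_left (by linear_combination (p * q * r + 1) * hprod)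
  have e2 : q ^ 2 * r ^ 2 = (p ^ 2)⁻¹ :=
    eq_inv_of_mul_eq_one_left (by linear_combination (p * q * r + 1) * hprod)
  have e3 : r ^ 2 * p ^ 2 = (q ^ 2)⁻¹ :=
    eq_inv_of_mul_eq_one_left (by linear_combination (p * q * r + 1) * hprod)
  simp only [e1, e2, e3, inv_inv] at hc hc'
  -- up to rounding, the six comparisons are the linear inequalities of the cone of reduced weights
  have hbound : ∀ {y x c : ℝ}, 0 < y → x ≤ c → y * x ≤ y * c := fun h h' =>
    mul_le_mul_of_nonneg_left h' h.le
  norm_num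
  apply add_pow_three_lt_of_reduced hpa hpb hpc
  · linarith [hbound hpa hp, hbound hpb hq, hbound hpc hr]
  · linarith [hbound hpa hq, hbound hpb hr, hbound hpc hp]
  · linarith [hbound hpa hr, hbound hpb hp, hbound hpc hq]
  · linarith [hbound hpa hip, hbound hpb hiq, hbound hpc hir]
  · linarith [hbound hpa hir, hbound hpb hip, hbound hpc hiq]
  · linarith [hbound hpa hiq, hbound hpb hir, hbound hpc hip]

theorem isFundamentalSystem_seven {t : RealEmb F → ℝ} (ht : Function.Injective t)
    (hroot : ∀ σ, t σ ^ 3 + t σ ^ 2 - 2 * t σ - 1 = 0) {g : Fin 2 → (𝓞 F)ˣ}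
    (hg0 : ∀ σ, sigmaMap (g 0 : F) σ = t σ ^ 2)
    (hg1 : ∀ σ, sigmaMap (g 1 : F) σ = (t σ ^ 2 - 2) ^ 2) : IsFundamentalSystem g := by
  refine (isReducing_seven ht hroot hg0 hg1).isFundamentalSystem fun a ha => ?_
  obtain ⟨e, he⟩ := exists_equiv_seven ht hroot
  obtain ⟨hr0, hr1, hr2⟩ := root_relations_seven ht hroot he
  obtain ⟨hp', -⟩ := sq_bounds_rootInterval_zero (he 0)
  obtain ⟨hq', hq⟩ := sq_bounds_rootInterval_one (he 1)
  obtain ⟨hr', -⟩ := sq_bounds_rootInterval_two (he 2)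
  have hlog : ∀ σ, a 0 * Real.log (sigmaMap (g 0 : F) σ) +
      a 1 * Real.log (sigmaMap (g 1 : F) σ) = 0 := by
    intro σ
    have h := congrArg Real.log (ha σ)
    rw [Fin.prod_univ_two, Real.log_mul (zpow_pos (sigmaMap_unit_pos _ σ) _).ne'
      (zpow_pos (sigmaMap_unit_pos _ σ) _).ne', Real.log_zpow, Real.log_zpow, Real.log_one] at h
    exact h
  have h0 := hlog (e 0)
  have h2 := hlog (e 2)
  rw [hg0, hg1, ← hr0] at h0
  rw [hg0, hg1, ← hr2] at h2
  have hp : 0 < Real.log (t (e 0) ^ 2) := Real.log_pos (by linarith)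
  have hq : Real.log (t (e 1) ^ 2) < 0 := Real.log_neg (by linarith) (by linarith)
  have hr : 0 < Real.log (t (e 2) ^ 2) := Real.log_pos (by linarith)
  set P := Real.log (t (e 0) ^ 2)
  set Q := Real.log (t (e 1) ^ 2)
  set R := Real.log (t (e 2) ^ 2)
  -- the determinant of the two logarithmic relations is `P ^ 2 - Q R > 0`
  have hdet : 0 < P ^ 2 - Q * R := by nlinarith
  have hA : (a 0 : ℝ) = 0 := by
    have : (a 0 : ℝ) * (P ^ 2 - Q * R) = 0 := by linear_combination P * h0 - Q * h2
    exact (mul_eq_zero.1 this).resolve_right hdet.ne'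
  have hB : (a 1 : ℝ) = 0 := by
    have : (a 1 : ℝ) * (P ^ 2 - Q * R) = 0 := by linear_combination P * h2 - R * h0
    exact (mul_eq_zero.1 this).resolve_right hdet.ne'
  ext i
  fin_cases i
  · exact_mod_cast hA
  · exact_mod_cast hB

omit [IsCMField F] [IsCyclotomicExtension {7} ℚ F] in
/-- The two orderings of `ζ + ζ⁻¹` and `ζ² + ζ⁻²` give the values `49 / 27` and `56 / 27`. With `x`
one of the numbers `2 cos (2πj/7)`, all entries are quadratic polynomials in `x`. -/
theorem boundValues_seven {t : RealEmb F → ℝ} (ht : Function.Injective t)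
    (hroot : ∀ σ, t σ ^ 3 + t σ ^ 2 - 2 * t σ - 1 = 0) {g : Fin 2 → (𝓞 F)ˣ}
    (hg0 : ∀ σ, sigmaMap (g 0 : F) σ = t σ ^ 2)
    (hg1 : ∀ σ, sigmaMap (g 1 : F) σ = (t σ ^ 2 - 2) ^ 2) (e : Fin 3 ≃ RealEmb F) :
    boundValues e g = {49 / 27, 56 / 27} := by
  have hne : ∀ i j, i ≠ j → t (e i) ≠ t (e j) := fun i j hij h => hij (e.injective (ht h))
  set x := t (e 0) with hx
  have h := hroot (e 0)
  rw [← hx] at h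
  have hA0 : sigmaMap (g 0 : F) (e 0) = x ^ 2 := hg0 _
  have hB0 : sigmaMap (g 1 : F) (e 0) = 3 - x - x ^ 2 := by
    rw [hg1, ← hx]; linear_combination (x - 1) * h
  -- the values at the embeddings with coordinates `x ^ 2 - 2` and `1 - x - x ^ 2`
  have hA1 : ∀ σ, t σ = x ^ 2 - 2 → sigmaMap (g 0 : F) σ = 3 - x - x ^ 2 := fun σ hσ => by
    rw [hg0, hσ]; linear_combination (x - 1) * h
  have hA2 : ∀ σ, t σ = 1 - x - x ^ 2 → sigmaMap (g 0 : F) σ = 2 + x := fun σ hσ => by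
    rw [hg0, hσ]; linear_combination (x + 1) * h
  have hB1 : ∀ σ, t σ = x ^ 2 - 2 → sigmaMap (g 1 : F) σ = 2 + x := fun σ hσ => by
    rw [hg1, ← hg0, hA1 σ hσ]; linear_combination (x + 1) * h
  have hB2 : ∀ σ, t σ = 1 - x - x ^ 2 → sigmaMap (g 1 : F) σ = x ^ 2 := fun σ hσ => by
    rw [hg1, ← hg0, hA2 σ hσ]; ring
  have hv0 : ∀ s j, vertexMatrix e g s 0 j = 1 := by
    intro s j; simp [vertexMatrix, chainPoint]
  have hv1 : ∀ s j, vertexMatrix e g s 1 j = sigmaMap (g (s 0) : F) (e j) := by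
    intro s j; simp [vertexMatrix, chainPoint, Fin.prod_univ_two]
  have hv2 : ∀ s j, vertexMatrix e g s 2 j =
      sigmaMap (g (s 0) : F) (e j) * sigmaMap (g (s 1) : F) (e j) := by
    intro s j; simp [vertexMatrix, chainPoint, Fin.prod_univ_two, sigmaMap_mul]
  have hC0 : x ^ 2 * (3 - x - x ^ 2) = x ^ 2 - x := by linear_combination -x * h
  have hC1 : (3 - x - x ^ 2) * (2 + x) = 5 - x - 2 * x ^ 2 := by linear_combination -h
  have hC2 : (2 + x) * x ^ 2 = 1 + 2 * x + x ^ 2 := by linear_combination h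
  have hC0' := mul_comm (x ^ 2) (3 - x - x ^ 2) ▸ hC0
  have hC1' := mul_comm (3 - x - x ^ 2) (2 + x) ▸ hC1
  have hC2' := mul_comm (2 + x) (x ^ 2) ▸ hC2
  -- the determinant `D` and the product `b` of the minors are rational; they reduce to `d` and `c`
  have hfrac : ∀ {D b d c v : ℝ}, D = d → b = c → |(d / 3) ^ 3 / c| = v →
      |(D / 3) ^ 3 / b| = v := by
    rintro D b _ _ v rfl rfl h
    exact h
  have hval : simplexBound (vertexMatrix e g 1) = 49 / 27 ∧
      simplexBound (vertexMatrix e g (Equiv.swap 0 1)) = 56 / 27 := by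
    rw [simplexBound_three _ (hv0 1), simplexBound_three _ (hv0 _)]
    simp only [hv1, hv2, Equiv.swap_apply_left, Equiv.swap_apply_right, Equiv.Perm.coe_one, id,
      hA0, hB0]
    rcases eq_or_eq_of_root h (hroot (e 1)) (hne 0 1 (by decide)) with h1 | h1 <;>
    rcases eq_or_eq_of_root h (hroot (e 2)) (hne 0 2 (by decide)) with h2 | h2
    · exact absurd (h1.trans h2.symm) (hne 1 2 (by decide))
    · rw [hA1 _ h1, hA2 _ h2, hB1 _ h1, hB2 _ h2, hC0, hC1, hC2, hC0', hC1', hC2']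
      exact ⟨hfrac (d := -7) (c := 7) (by linear_combination -3 * x * h)
          (by linear_combination (x ^ 9 + 2 * x ^ 8 - 3 * x ^ 7 - 6 * x ^ 6 + 8
            * x ^ 5 + 10 * x ^ 4 - 11 * x ^ 3 - 5 * x ^ 2 + 12 * x - 1) * h)
          (by norm_num [abs_div, abs_of_neg]),
        hfrac (d := 14) (c := -49) (by linear_combination 6 * x * h)
          (by linear_combination (-8 * x ^ 9 - 16 * x ^ 8 + 24 * x ^ 7 + 48 * x
            ^ 6 - 58 * x ^ 5 - 74 * x ^ 4 + 82 * x ^ 3 + 55 * x ^ 2 - 89 * x - 13) * h)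
          (by norm_num [abs_div, abs_of_neg])⟩
    · rw [hA1 _ h2, hA2 _ h1, hB1 _ h2, hB2 _ h1, hC0, hC1, hC2, hC0', hC1', hC2']
      exact ⟨hfrac (d := 7) (c := -7) (by linear_combination 3 * x * h)
          (by linear_combination (-x ^ 9 - 2 * x ^ 8 + 3 * x ^ 7 + 6 * x ^ 6 -
            8 * x ^ 5 - 10 * x ^ 4 + 11 * x ^ 3 + 5 * x ^ 2 - 12 * x + 1) * h)
          (by norm_num [abs_div, abs_of_neg]),
        hfrac (d := -14) (c := 49) (by linear_combination -6 * x * h)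
          (by linear_combination (8 * x ^ 9 + 16 * x ^ 8 - 24 * x ^ 7 - 48 * x
            ^ 6 + 58 * x ^ 5 + 74 * x ^ 4 - 82 * x ^ 3 - 55 * x ^ 2 + 89 * x + 13) * h)
          (by norm_num [abs_div, abs_of_neg])⟩
    · exact absurd (h1.trans h2.symm) (hne 1 2 (by decide))
  have hperm : ∀ s : Equiv.Perm (Fin 2), s = 1 ∨ s = Equiv.swap 0 1 := by decide
  ext z
  simp only [boundValues, Set.mem_range, Set.mem_insert_iff, Set.mem_singleton_iff]
  constructor
  · rintro ⟨s, rfl⟩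
    rcases hperm s with rfl | rfl
    · exact Or.inl hval.1
    · exact Or.inr hval.2
  · rintro (rfl | rfl)
    · exact ⟨1, hval.1⟩
    · exact ⟨_, hval.2⟩

end Seven

/-! ### Minimal vectors and Craig lattices -/

section Main

variable {F : Type*} [Field F] [NumberField F] [IsCMField F]

theorem fieldNorm_le_mul_of_isMinimalVector
    (hlt : ∀ y : RealEmb F → ℝ, (∀ σ, 0 < y σ) → ∀ β : 𝓞 F, β ≠ 0 → ¬ IsUnit β →
      ∃ u : (𝓞 F)ˣ, weightedNorm y (u : F) < weightedNorm y (β : F))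
    {π : 𝓞 F} (hπ : π ≠ 0) {x : RealEmb F → ℝ} (hx : ∀ σ, 0 < x σ) {α : 𝓞 F}
    (hα : IsMinimalVector (Ideal.span {π}) x α) {c : ℝ} (hc : 1 ≤ c) :
    fieldNorm (α : F) ≤ c * fieldNorm (π : F) := by
  obtain ⟨u, rfl, -⟩ := (isMinimalVector_span_singleton_iff hlt hπ hx α).1 hα
  simp only [map_mul, fieldNorm_mul, fieldNorm_unit, mul_one]
  exact le_mul_of_one_le_left (zero_le_one.trans (one_le_fieldNorm hπ)) hc

theorem exists_isMinimalVector_span_singleton_iff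
    (hlt : ∀ y : RealEmb F → ℝ, (∀ σ, 0 < y σ) → ∀ β : 𝓞 F, β ≠ 0 → ¬ IsUnit β →
      ∃ u : (𝓞 F)ˣ, weightedNorm y (u : F) < weightedNorm y (β : F))
    {π : 𝓞 F} (hπ : π ≠ 0) (α : 𝓞 F) :
    (∃ x : RealEmb F → ℝ, (∀ σ, 0 < x σ) ∧ IsMinimalVector (Ideal.span {π}) x α) ↔
      ∃ u : (𝓞 F)ˣ, α = π * u := by
  constructor
  · rintro ⟨x, hx, hα⟩
    obtain ⟨u, hu, -⟩ := (isMinimalVector_span_singleton_iff hlt hπ hx α).1 hα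
    exact ⟨u, hu⟩
  · rintro ⟨u, rfl⟩
    obtain ⟨x, hx, h⟩ := exists_isMinimalVector_span_singleton (mul_ne_zero hπ u.ne_zero)
    refine ⟨x, hx, ?_⟩
    rwa [Ideal.span_singleton_mul_right_unit u.isUnit] at h

/-- The shortest vectors of a Craig lattice are the shortest unit multiples of `(1 - ζ)^r`. -/
theorem bijOn_evalAt {m : ℕ} [IsCyclotomicExtension {m + 1} ℚ F] {ζ : 𝓞 F}
    (hlt : ∀ y : RealEmb F → ℝ, (∀ σ, 0 < y σ) → ∀ β : 𝓞 F, β ≠ 0 → ¬ IsUnit β →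
      ∃ u : (𝓞 F)ˣ, weightedNorm y (u : F) < weightedNorm y (β : F))
    (hp : (m + 1).Prime) (h5 : 5 ≤ m + 1) (hζ : IsPrimitiveRoot ζ (m + 1)) (r : ℕ) :
    Set.BijOn (evalAt ζ) {v | IsShortest (craigLattice m r) v}
      {α : 𝓞 F | ∃ u : (𝓞 F)ˣ, α = (1 - ζ) ^ r * u ∧ ∀ u' : (𝓞 F)ˣ,
        weightedNorm (fun _ => 1) (((1 - ζ) ^ r * u : 𝓞 F) : F) ≤
          weightedNorm (fun _ => 1) (((1 - ζ) ^ r * u' : 𝓞 F) : F)} := by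
  rcases eq_or_ne r 0 with rfl | hr
  · simpa only [pow_zero, one_mul] using bijOn_evalAt_zero (F := F) hp h5 hζ
  · have hπ : (1 - ζ) ^ r ≠ 0 := pow_ne_zero r (sub_ne_zero.2 (hζ.ne_one hp.one_lt).symm)
    have h := bijOn_evalAt_isMinimalVector (F := F) hp h5 hζ hr
    have hset := Set.ext (isMinimalVector_span_singleton_iff hlt hπ (x := fun _ => 1)
      fun _ => one_pos)
    exact hset ▸ h

end Main

end CraigLattice

theorem mainTheorem4 (n : ℕ) (hn : n = 5 ∨ n = 7) (F : Type*) [Field F] [NumberField F]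
    [IsCyclotomicExtension {n} ℚ F] (ζ : 𝓞 F) (hζ : IsPrimitiveRoot ζ n) :
    -- the bound for `n = 5`
    (n = 5 →
      Fintype.card (CraigLattice.RealEmb F) = 2 ∧
      (∃ g : Fin 1 → (𝓞 F)ˣ, CraigLattice.IsFundamentalSystem g) ∧
      (∀ g : Fin 1 → (𝓞 F)ˣ, CraigLattice.IsFundamentalSystem g →
        ∀ e : Fin 2 ≃ CraigLattice.RealEmb F, CraigLattice.boundValues e g = {5 / 4}) ∧
      (∀ (r : ℕ) (x : CraigLattice.RealEmb F → ℝ), (∀ σ, 0 < x σ) → ∀ α : 𝓞 F,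
        CraigLattice.IsMinimalVector (Ideal.span {(1 - ζ) ^ r}) x α →
          CraigLattice.fieldNorm (α : F) ≤
            5 / 4 * CraigLattice.fieldNorm (((1 - ζ) ^ r : 𝓞 F) : F))) ∧
    -- the bound for `n = 7`
    (n = 7 →
      Fintype.card (CraigLattice.RealEmb F) = 3 ∧
      (∃ g : Fin 2 → (𝓞 F)ˣ, CraigLattice.IsFundamentalSystem g ∧
        ∀ e : Fin 3 ≃ CraigLattice.RealEmb F,
          CraigLattice.boundValues e g = {49 / 27, 56 / 27}) ∧
      (∀ (r : ℕ) (x : CraigLattice.RealEmb F → ℝ), (∀ σ, 0 < x σ) → ∀ α : 𝓞 F,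
        CraigLattice.IsMinimalVector (Ideal.span {(1 - ζ) ^ r}) x α →
          CraigLattice.fieldNorm (α : F) ≤
            56 / 27 * CraigLattice.fieldNorm (((1 - ζ) ^ r : 𝓞 F) : F))) ∧
    -- nonzero non-units have norm at least `n`
    (∀ β : 𝓞 F, β ≠ 0 → ¬ IsUnit β → (n : ℝ) ≤ CraigLattice.fieldNorm (β : F)) ∧
    -- for every choice of positive weights, the minimal vectors of the ideal `((1 - ζ)^r)`
    (∀ (r : ℕ) (x : CraigLattice.RealEmb F → ℝ), (∀ σ, 0 < x σ) → ∀ α : 𝓞 F,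
      CraigLattice.IsMinimalVector (Ideal.span {(1 - ζ) ^ r}) x α ↔
        ∃ u : (𝓞 F)ˣ, α = (1 - ζ) ^ r * u ∧
          ∀ u' : (𝓞 F)ˣ,
            CraigLattice.weightedNorm x (((1 - ζ) ^ r * u : 𝓞 F) : F) ≤
              CraigLattice.weightedNorm x (((1 - ζ) ^ r * u' : 𝓞 F) : F)) ∧
    -- the vectors that are minimal for some choice of positive weights
    (∀ (r : ℕ) (α : 𝓞 F),
      (∃ x : CraigLattice.RealEmb F → ℝ, (∀ σ, 0 < x σ) ∧
        CraigLattice.IsMinimalVector (Ideal.span {(1 - ζ) ^ r}) x α) ↔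
      ∃ u : (𝓞 F)ˣ, α = (1 - ζ) ^ r * u) ∧
    -- the minimal vectors of the Craig lattices: equal weights
    (∀ r : ℕ,
      Set.BijOn (CraigLattice.evalAt ζ)
        {v | CraigLattice.IsShortest (CraigLattice.craigLattice (n - 1) r) v}
        {α : 𝓞 F | ∃ u : (𝓞 F)ˣ, α = (1 - ζ) ^ r * u ∧
          ∀ u' : (𝓞 F)ˣ,
            CraigLattice.weightedNorm (fun _ => 1) (((1 - ζ) ^ r * u : 𝓞 F) : F) ≤
              CraigLattice.weightedNorm (fun _ => 1) (((1 - ζ) ^ r * u' : 𝓞 F) : F)}) := by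
  have hp : n.Prime := by rcases hn with rfl | rfl <;> norm_num
  have h5 : 5 ≤ n := by omega
  have hCM : IsCMField F := IsCyclotomicExtension.Rat.isCMField F (S := {n}) ⟨n, rfl, by omega⟩
  have hπ : ∀ r, (1 - ζ) ^ r ≠ 0 := fun r =>
    pow_ne_zero r (sub_ne_zero.2 (hζ.ne_one hp.one_lt).symm)
  have hnorm : ∀ β : 𝓞 F, β ≠ 0 → ¬ IsUnit β → (n : ℝ) ≤ CraigLattice.fieldNorm (β : F) :=
    fun β h0 hβ => CraigLattice.le_fieldNorm_of_not_isUnit hp hζ h0 hβ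
  have hlt : ∀ y : CraigLattice.RealEmb F → ℝ, (∀ σ, 0 < y σ) → ∀ β : 𝓞 F, β ≠ 0 → ¬ IsUnit β →
      ∃ u : (𝓞 F)ˣ, CraigLattice.weightedNorm y (u : F) < CraigLattice.weightedNorm y (β : F) := by
    intro y hy β h0 hβ
    have h0' : (β : F) ≠ 0 := by simpa using h0
    rcases hn with rfl | rfl
    · obtain ⟨ε, t, ht, hroot, hε⟩ := CraigLattice.exists_unit_five hζ
      -- `3 ^ 2 ≤ 2 ^ 2 * 5`
      exact (CraigLattice.isReducing_five ht hroot hε (Subgroup.mem_top ε)).exists_weightedNorm_lt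
        (by rw [CraigLattice.card_realEmb_five]; norm_num) hy h0' (hnorm β h0 hβ)
    · obtain ⟨g, t, ht, hroot, hg0, hg1⟩ := CraigLattice.exists_units_seven hζ
      -- `4 ^ 3 ≤ 3 ^ 3 * 7`
      exact (CraigLattice.isReducing_seven ht hroot hg0 hg1).exists_weightedNorm_lt
        (by rw [CraigLattice.card_realEmb_seven]; norm_num) hy h0' (hnorm β h0 hβ)
  refine ⟨?_, ?_, hnorm,
    fun r x hx α => CraigLattice.isMinimalVector_span_singleton_iff hlt (hπ r) hx α,
    fun r α => CraigLattice.exists_isMinimalVector_span_singleton_iff hlt (hπ r) α, fun r => ?_⟩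
  · rintro rfl
    obtain ⟨ε, t, ht, hroot, hε⟩ := CraigLattice.exists_unit_five hζ
    exact ⟨CraigLattice.card_realEmb_five,
      ⟨_, CraigLattice.isFundamentalSystem_five ht hroot hε⟩,
      fun g hg e => CraigLattice.boundValues_five ht hroot hε hg e,
      fun r x hx α hα => CraigLattice.fieldNorm_le_mul_of_isMinimalVector hlt (hπ r) hx hα
        (by norm_num)⟩
  · rintro rfl
    obtain ⟨g, t, ht, hroot, hg0, hg1⟩ := CraigLattice.exists_units_seven hζ
    exact ⟨CraigLattice.card_realEmb_seven,
      ⟨g, CraigLattice.isFundamentalSystem_seven ht hroot hg0 hg1,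
        fun e => CraigLattice.boundValues_seven ht hroot hg0 hg1 e⟩,
      fun r x hx α hα => CraigLattice.fieldNorm_le_mul_of_isMinimalVector hlt (hπ r) hx hα
        (by norm_num)⟩
  · rcases hn with rfl | rfl
    · exact CraigLattice.bijOn_evalAt (m := 4) hlt hp h5 hζ r
    · exact CraigLattice.bijOn_evalAt (m := 6) hlt hp h5 hζ r
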